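/- **Lemma (Gårding-type inequality).** Let $\Omega\subset\mathbb R^d$, $d\in\{2,3\}$, be a bounded convex polytopal domain, and consider the operator $-\nabla\cdot(a\nabla u)+\vec b\cdot\nabla u+a_0u$, where $a\in W^{1,\infty}(\Omega)$ (identified with its continuous representative on $\overline\Omega$), $\vec b\in L^\infty(\Omega)^d$, $a_0\in L^\infty(\Omega)$, $a_0\ge 0$, and $a\ge\alpha$ on $\overline\Omega$ for some $\alpha>0$. Let $k\ge 0$. *Meshes.* A mesh $\mathcal T_h$ of $\Omega$ is a finite set of nonempty, pairwise disjoint open polyhedral cells $T\subset\Omega$ with $\overline\Omega=\bigcup_T\overline T$, together with a finite set $\mathcal F_h$ of closed faces $F$, each contained in a hyperplane, of positive $(d-1)$-dimensional measure, and contained either in $\partial T_1\cap\partial T_2$ for two distinct cells or in $\partial T\cap\partial\Omega$ for one cell; the faces cover $\bigcup_T\partial T$ and overlap only in sets of zero $(d-1)$-dimensional measure. Let $\mathcal F_T=\{F\in\mathcal F_h: F\subset\partial T\}$, let $h_F$ be the diameter of $F$, and let $\boldsymbol n_{TF}$ be the unit normal to $F$ pointing out of $T$. Let $(\mathcal T_h)_h$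 be an admissible family of such meshes: there is $\varrho\in(0,1)$ such that every $\mathcal T_h$ has a matching simplicial submesh, each simplex of which lies in a cell of $\mathcal T_h$ and each simplex face of which, if it lies in $\bigcup_T\partial T$, lies in a face of $\mathcal T_h$; each simplex contains a ball of radius $\varrho$ times its diameter; and each simplex (resp. simplex face) has diameter at least $\varrho$ times that of the cell (resp. face) in which it lies. *Discrete spaces and operators.* Let $\underline U_h^k=\big(\times_{T}\mathbb P^k_d(T)\big)\times\big(\times_{F\in\mathcal F_h}\mathbb P^k_{d-1}(F)\big)$, write $\underline v_T=(v_T,(v_F)_{F\in\mathcal F_T})$ for the restriction of $\underline v_h\in\underline U_h^k$ to $T$, and let $v_h|_T=v_T$. Let $(\cdot,\cdot)_X$ and $\|\cdot\|_X$ be the inner product and norm of $L^2(X)$, let $\|\cdot\|=\|\cdot\|_\Omega$, and let $\pi_T^k,\pi_F^k$ be the $L^2$-orthogonal projections onto $\mathbb P^k_d(T)$, $\mathbb P^k_{d-1}(F)$. Define $\boldsymbol G_T^k\underline v_T\in\mathbb P_d^k(T)^d$ and $R_T^{k+1}\underline v_T\in\mathbb P_d^{k+1}(T)$ by $$(\boldsymbol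 G_T^k\underline v_T,\boldsymbol\tau)_T=(\nabla v_T,\boldsymbol\tau)_T+\sum_{F\in\mathcal F_T}(v_F-v_T,\boldsymbol\tau\cdot\boldsymbol n_{TF})_F\quad\forall\boldsymbol\tau\in\mathbb P_d^k(T)^d,$$ $$(\nabla R_T^{k+1}\underline v_T,\nabla w)_T=(\nabla v_T,\nabla w)_T+\sum_{F\in\mathcal F_T}(v_F-v_T,\nabla w\cdot\boldsymbol n_{TF})_F\quad\forall w\in\mathbb P_d^{k+1}(T),\qquad (R_T^{k+1}\underline v_T,1)_T=(v_T,1)_T,$$ and, for $F\in\mathcal F_T$, $S_F^k\underline v_T=\pi_F^k\big(v_F-v_T-(R_T^{k+1}\underline v_T-\pi_T^kR_T^{k+1}\underline v_T)\big)$. With $a_{TF}^\infty=\|a\|_{L^\infty(F)}$, set $$B_h(\underline u_h,\underline v_h)=\sum_T\Big[(a\,\boldsymbol G_T^k\underline u_T,\boldsymbol G_T^k\underline v_T)_T+\sum_{F\in\mathcal F_T}\frac{a_{TF}^\infty}{h_F}(S_F^k\underline u_T,S_F^k\underline v_T)_F+(\vec b\cdot\nabla R_T^{k+1}\underline u_T,v_T)_T+(a_0u_T,v_T)_T\Big],$$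 $$\|\underline v_h\|_{a,h}^2=\sum_T\Big[\|a^{1/2}\boldsymbol G_T^k\underline v_T\|_T^2+\sum_{F\in\mathcal F_T}\frac{a_{TF}^\infty}{h_F}\|v_F-v_T\|_F^2\Big].$$ *Claim.* There exist constants $C_1,C_2>0$, independent of $h$, such that for every mesh $\mathcal T_h$ of the family $$B_h(\underline v_h,\underline v_h)\ \ge\ C_1\|\underline v_h\|_{a,h}^2-C_2\|v_h\|^2\qquad\forall\,\underline v_h\in\underline U_h^k.$$ -/

import Mathlib

open MeasureTheory Set

namespace HHO

noncomputable section

/-- The Euclidean space `ℝ^d`. -/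
abbrev Euc (d : ℕ) := EuclideanSpace ℝ (Fin d)

/-! ### Polynomials -/

/-- Polynomials in `d` variables of total degree at most `k`. A cell is open and nonempty, so that
this is also the space of polynomial functions of degree at most `k` on a cell. -/
abbrev Poly (d k : ℕ) : Submodule ℝ (MvPolynomial (Fin d) ℝ) :=
  MvPolynomial.restrictTotalDegree (Fin d) ℝ k

/-- Value of a polynomial at a point. -/
def ev {d : ℕ} (p : MvPolynomial (Fin d) ℝ) (x : Euc d) : ℝ :=
  MvPolynomial.eval (fun i => x i) p

/-- Value of a vector of polynomials at a point. -/
def evVec {d : ℕ} (τ : Fin d → MvPolynomial (Fin d) ℝ) (x : Euc d) : Euc d :=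
  WithLp.toLp 2 (fun i => ev (τ i) x)

/-- Gradient of a polynomial. -/
def grad {d : ℕ} (p : MvPolynomial (Fin d) ℝ) : Fin d → MvPolynomial (Fin d) ℝ :=
  fun i => MvPolynomial.pderiv i p

/-- Restriction of a polynomial to a set, as a linear map. -/
def restr {d : ℕ} (F : Set (Euc d)) : MvPolynomial (Fin d) ℝ →ₗ[ℝ] (F → ℝ) where
  toFun p := fun x => ev p x
  map_add' p q := by funext x; simp [ev]
  map_smul' c p := by funext x; simp [ev]

/-- Polynomial functions of degree at most `k` on a face `F`. As `F` lies in a hyperplane `H`, and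
polynomials of degree at most `k` on `H` are the restrictions of those on `ℝ^d`, these are the
polynomials of degree at most `k` in `d - 1` variables on `F`. -/
def FacePoly {d : ℕ} (k : ℕ) (F : Set (Euc d)) : Submodule ℝ (F → ℝ) :=
  (Poly d k).map (restr F)

/-! ### Domain and coefficients -/

/-- Bounded convex polytopal domains: the nonempty interiors of convex hulls of finite sets. -/
def IsConvexPolytopalDomain {d : ℕ} (Ω : Set (Euc d)) : Prop :=
  Ω.Nonempty ∧ ∃ s : Finset (Euc d), Ω = interior (convexHull ℝ (s : Set (Euc d)))

/-- `a ∈ W^{1,∞}(Ω)`: both `a` and its weak gradient are essentially bounded on `Ω`. -/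
def MemW1Infty {d : ℕ} (Ω : Set (Euc d)) (a : Euc d → ℝ) : Prop :=
  MemLp a ⊤ (volume.restrict Ω) ∧
  ∃ g : Euc d → Euc d, MemLp g ⊤ (volume.restrict Ω) ∧
    ∀ φ : Euc d → ℝ, ContDiff ℝ ((⊤ : ℕ∞) : WithTop ℕ∞) φ → HasCompactSupport φ → tsupport φ ⊆ Ω →
      ∀ i : Fin d,
        ∫ x in Ω, a x * fderiv ℝ φ x (EuclideanSpace.single i 1) = - ∫ x in Ω, g x i * φ x

/-- Assumptions on the coefficients of `-∇·(a ∇u) + b·∇u + a₀ u`. A function in `W^{1,∞}(Ω)` on a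
convex domain has a unique representative that is continuous on `closure Ω`; `a` denotes this
representative, which gives a meaning to the values of `a` on the boundary and on faces. -/
structure CoeffAssumption {d : ℕ} (Ω : Set (Euc d)) (a : Euc d → ℝ) (b : Euc d → Euc d)
    (a₀ : Euc d → ℝ) : Prop where
  elliptic : ∃ α : ℝ, 0 < α ∧ ∀ x ∈ closure Ω, α ≤ a x
  a_mem : MemW1Infty Ω a
  a_cont : ContinuousOn a (closure Ω)
  b_mem : MemLp b ⊤ (volume.restrict Ω)
  a₀_mem : MemLp a₀ ⊤ (volume.restrict Ω)
  a₀_nonneg : ∀ᵐ x ∂(volume.restrict Ω), 0 ≤ a₀ x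

/-! ### Meshes -/

/-- Open polyhedra: interiors of finite unions of nondegenerate closed simplices. Neither convexity
nor connectedness is required. -/
def IsOpenPolyhedron {d : ℕ} (T : Set (Euc d)) : Prop :=
  ∃ S : Finset (Finset (Euc d)),
    (∀ s ∈ S, s.card = d + 1 ∧ AffineIndependent ℝ ((↑) : s → Euc d)) ∧
    T = interior (⋃ s ∈ S, convexHull ℝ (s : Set (Euc d)))

/-- A polytopal mesh of `Ω`, with its cells `T` and faces `F`. The hyperplane `H_F` that contains
the face `F` is `{x | ⟪faceNormal F, x⟫ = faceOffset F}`, where `faceNormal F` is a unit vector. -/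
structure Mesh {d : ℕ} (Ω : Set (Euc d)) where
  cells : Finset (Set (Euc d))
  cell_nonempty : ∀ T ∈ cells, T.Nonempty
  cell_polyhedron : ∀ T ∈ cells, IsOpenPolyhedron T
  cell_subset : ∀ T ∈ cells, T ⊆ Ω
  cell_disjoint : ∀ T ∈ cells, ∀ T' ∈ cells, T ≠ T' → Disjoint T T'
  cell_cover : closure Ω = ⋃ T ∈ cells, closure T
  faces : Finset (Set (Euc d))
  faceNormal : Set (Euc d) → Euc d
  faceOffset : Set (Euc d) → ℝ
  face_closed : ∀ F ∈ faces, IsClosed F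
  faceNormal_unit : ∀ F ∈ faces, ‖faceNormal F‖ = 1
  face_hyperplane : ∀ F ∈ faces, ∀ x ∈ F, inner ℝ (faceNormal F) x = faceOffset F
  face_measure_pos : ∀ F ∈ faces, 0 < (μHE[d - 1] : Measure (Euc d)) F
  /-- Every face is an internal face or a boundary face. -/
  face_internal_or_boundary : ∀ F ∈ faces,
    (∃ T₁ ∈ cells, ∃ T₂ ∈ cells, T₁ ≠ T₂ ∧ F ⊆ frontier T₁ ∩ frontier T₂) ∨
    (∃ T ∈ cells, F ⊆ frontier T ∩ frontier Ω)
  /-- The faces form a partition of the mesh skeleton (up to null sets, as faces are closed). -/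
  face_cover : ⋃ T ∈ cells, frontier T = ⋃ F ∈ faces, F
  face_overlap : ∀ F ∈ faces, ∀ F' ∈ faces, F ≠ F' →
    (μHE[d - 1] : Measure (Euc d)) (F ∩ F') = 0

variable {d : ℕ} {Ω : Set (Euc d)}

/-- The simplicial complex `K` is a matching simplicial submesh of the mesh `M`: its `d`-simplices
lie in cells of `M`, and those of its `(d-1)`-simplices that lie in the skeleton of `M` (and not
inside a cell) lie in faces of `M`. -/
structure Mesh.IsMatchingSubmesh (M : Mesh Ω) (K : Geometry.SimplicialComplex ℝ (Euc d)) :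
    Prop where
  finite : K.faces.Finite
  space_eq : K.space = closure Ω
  simplex_subset : ∀ s ∈ K.faces, s.card = d + 1 →
    ∃ T ∈ M.cells, interior (convexHull ℝ (s : Set (Euc d))) ⊆ T
  subface_subset : ∀ s ∈ K.faces, s.card = d →
    convexHull ℝ (s : Set (Euc d)) ⊆ ⋃ T ∈ M.cells, frontier T →
      ∃ F ∈ M.faces, convexHull ℝ (s : Set (Euc d)) ⊆ F

/-- Mesh regularity with parameter `ϱ`: there is a matching simplicial submesh that is shape-regular
(the inradius of a simplex is at least `ϱ` times its diameter), whose simplices and faces have a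
diameter of at least `ϱ` times that of the cells and faces of `M` in which they lie. -/
def Mesh.IsRegular (M : Mesh Ω) (ϱ : ℝ) : Prop :=
  ∃ K : Geometry.SimplicialComplex ℝ (Euc d), M.IsMatchingSubmesh K ∧
    (∀ s ∈ K.faces, s.card = d + 1 →
      ∃ c, Metric.ball c (ϱ * Metric.diam (convexHull ℝ (s : Set (Euc d)))) ⊆
        convexHull ℝ (s : Set (Euc d))) ∧
    (∀ s ∈ K.faces, s.card = d + 1 → ∀ T ∈ M.cells,
      interior (convexHull ℝ (s : Set (Euc d))) ⊆ T →
        ϱ * Metric.diam T ≤ Metric.diam (convexHull ℝ (s : Set (Euc d)))) ∧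
    (∀ s ∈ K.faces, s.card = d → ∀ F ∈ M.faces,
      convexHull ℝ (s : Set (Euc d)) ⊆ F →
        ϱ * Metric.diam F ≤ Metric.diam (convexHull ℝ (s : Set (Euc d))))

/-- A family of meshes is admissible if all its members are regular with the same parameter. -/
def IsAdmissible {ι : Type*} (𝓣 : ι → Mesh Ω) : Prop :=
  ∃ ϱ : ℝ, 0 < ϱ ∧ ϱ < 1 ∧ ∀ i, (𝓣 i).IsRegular ϱ

namespace Mesh

open Classical in
/-- The faces contained in the boundary of `T`. -/
def facesOf (M : Mesh Ω) (T : Set (Euc d)) : Finset (Set (Euc d)) :=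
  M.faces.filter (fun F => F ⊆ frontier T)

theorem mem_faces_of_mem_facesOf (M : Mesh Ω) {T F : Set (Euc d)} (h : F ∈ M.facesOf T) :
    F ∈ M.faces := by
  classical
  unfold facesOf at h
  exact (Finset.mem_filter.mp h).1

open Classical in
/-- The unit normal to the face `F` pointing out of `T`, at the point `x` of `F`: near `x`, the cell
`T` is the side of `H_F` that this vector points away from. (The value `0` occurs only at the
exceptional points of `F`, a null set, where `T` is not locally a half-space.) -/
def normal (M : Mesh Ω) (T F : Set (Euc d)) (x : Euc d) : Euc d :=
  if ∀ᶠ y in nhds x, (y ∈ T ↔ inner ℝ (M.faceNormal F) y < M.faceOffset F) then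
    M.faceNormal F
  else if ∀ᶠ y in nhds x, (y ∈ T ↔ M.faceOffset F < inner ℝ (M.faceNormal F) y) then
    - M.faceNormal F
  else 0

/-! ### Degrees of freedom -/

/-- The local space of degrees of freedom on the cell `T`. -/
abbrev LocalDof (M : Mesh Ω) (k : ℕ) (T : Set (Euc d)) :=
  Poly d k × (∀ F : M.facesOf T, FacePoly k F.1)

/-- The global space of degrees of freedom, with one polynomial for each cell and each face. -/
abbrev Dof (M : Mesh Ω) (k : ℕ) :=
  (∀ _ : M.cells, Poly d k) × (∀ F : M.faces, FacePoly k F.1)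

/-- The local degrees of freedom `(v_T, (v_F))` of `v` on the cell `T`. -/
def Dof.loc {M : Mesh Ω} {k : ℕ} (v : M.Dof k) (T : M.cells) : M.LocalDof k T.1 :=
  (v.1 T, fun F => v.2 ⟨F.1, M.mem_faces_of_mem_facesOf F.2⟩)

open Classical in
/-- The function `v_h` with `v_h = v_T` on each cell `T`. -/
def Dof.cellFun {M : Mesh Ω} {k : ℕ} (v : M.Dof k) (x : Euc d) : ℝ :=
  ∑ T : M.cells, if x ∈ T.1 then ev (v.1 T).1 x else 0

end Mesh

/-- Surface measure on a face. -/
def surf (F : Set (Euc d)) : Measure F :=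
  (μHE[d - 1] : Measure (Euc d)).comap Subtype.val

/-! ### Projections, reconstructions and stabilization

Each operator is the solution, unique on the cells and faces of a mesh, of a finite-dimensional
linear problem. -/

/-- `L²`-orthogonal projection of `f` onto the polynomials of degree at most `k` on the cell `T`. -/
def cellProj (k : ℕ) (T : Set (Euc d)) (f : Euc d → ℝ) : Poly d k :=
  Classical.epsilon fun q : Poly d k =>
    ∀ w : Poly d k, ∫ x in T, ev q.1 x * ev w.1 x = ∫ x in T, f x * ev w.1 x

/-- `L²`-orthogonal projection of `f` onto the polynomials of degree at most `k` on the face `F`. -/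
def faceProj (k : ℕ) (F : Set (Euc d)) (f : F → ℝ) : FacePoly k F :=
  Classical.epsilon fun q : FacePoly k F =>
    ∀ w : FacePoly k F, ∫ x, q.1 x * w.1 x ∂(surf F) = ∫ x, f x * w.1 x ∂(surf F)

namespace Mesh

variable (M : Mesh Ω) {k : ℕ} (T : Set (Euc d))

/-- `(∇v_T, τ)_T + ∑_F (v_F - v_T, τ·n_TF)_F` for a vector `τ` of polynomials. -/
def reconRhs (v : M.LocalDof k T) (τ : Fin d → MvPolynomial (Fin d) ℝ) : ℝ :=
  (∫ x in T, inner ℝ (evVec (grad v.1.1) x) (evVec τ x)) +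
  ∑ F : M.facesOf T,
    ∫ x : F.1, ((v.2 F).1 x - ev v.1.1 x) * inner ℝ (evVec τ x) (M.normal T F.1 x) ∂(surf F.1)

/-- The potential reconstruction `R_T^{k+1}`. -/
def potRecon (v : M.LocalDof k T) : Poly d (k + 1) :=
  Classical.epsilon fun r : Poly d (k + 1) =>
    (∀ w : Poly d (k + 1),
      ∫ x in T, inner ℝ (evVec (grad r.1) x) (evVec (grad w.1) x) = M.reconRhs T v (grad w.1)) ∧
    ∫ x in T, ev r.1 x = ∫ x in T, ev v.1.1 x

/-- The gradient reconstruction `G_T^k`. -/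
def gradRecon (v : M.LocalDof k T) : Fin d → Poly d k :=
  Classical.epsilon fun g : Fin d → Poly d k =>
    ∀ τ : Fin d → Poly d k,
      ∫ x in T, inner ℝ (evVec (fun i => (g i).1) x) (evVec (fun i => (τ i).1) x) =
        M.reconRhs T v (fun i => (τ i).1)

/-- `G_T^k v`, as a vector field. -/
def G (v : M.LocalDof k T) (x : Euc d) : Euc d :=
  evVec (fun i => (M.gradRecon T v i).1) x

/-- `∇ R_T^{k+1} v`, as a vector field. -/
def gradR (v : M.LocalDof k T) (x : Euc d) : Euc d :=
  evVec (grad (M.potRecon T v).1) x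

/-- The stabilization operator
`S_F^k v = π_F^k (v_F - v_T - (R_T^{k+1} v - π_T^k R_T^{k+1} v))`. -/
def stabOp (v : M.LocalDof k T) (F : M.facesOf T) : FacePoly k F.1 :=
  faceProj k F.1 fun x =>
    (v.2 F).1 x - ev v.1.1 x -
      (ev (M.potRecon T v).1 x - ev (cellProj k T (ev (M.potRecon T v).1)).1 x)

end Mesh

/-- `a_TF = ‖a‖_{L^∞(F)}`. -/
def faceSup (a : Euc d → ℝ) (F : Set (Euc d)) : ℝ :=
  (eLpNorm (fun x : F => a x) ⊤ (surf F)).toReal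

/-! ### Bilinear forms and norms -/

namespace Mesh

variable (M : Mesh Ω) {k : ℕ} (T : Set (Euc d))

/-- The stabilization term `s_T`. -/
def stab (a : Euc d → ℝ) (u v : M.LocalDof k T) : ℝ :=
  ∑ F : M.facesOf T, faceSup a F.1 / Metric.diam F.1 *
    ∫ x, (M.stabOp T u F).1 x * (M.stabOp T v F).1 x ∂(surf F.1)

/-- The local bilinear form `B_T`. -/
def localForm (a : Euc d → ℝ) (b : Euc d → Euc d) (a₀ : Euc d → ℝ) (u v : M.LocalDof k T) : ℝ :=
  (∫ x in T, a x * inner ℝ (M.G T u x) (M.G T v x)) + M.stab T a u v +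
  (∫ x in T, inner ℝ (b x) (M.gradR T u x) * ev v.1.1 x) +
  ∫ x in T, a₀ x * ev u.1.1 x * ev v.1.1 x

/-- The square of the local energy seminorm `‖v_T‖_{a,T}`. -/
def localEnergySq (a : Euc d → ℝ) (v : M.LocalDof k T) : ℝ :=
  (∫ x in T, ‖Real.sqrt (a x) • M.G T v x‖ ^ 2) +
  ∑ F : M.facesOf T, faceSup a F.1 / Metric.diam F.1 *
    ∫ x : F.1, ((v.2 F).1 x - ev v.1.1 x) ^ 2 ∂(surf F.1)

/-- The global bilinear form `B_h`. -/
def form (a : Euc d → ℝ) (b : Euc d → Euc d) (a₀ : Euc d → ℝ) (u v : M.Dof k) : ℝ :=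
  ∑ T : M.cells, M.localForm T.1 a b a₀ (u.loc T) (v.loc T)

/-- The energy seminorm `‖v‖_{a,h}`. -/
def energyNorm (a : Euc d → ℝ) (v : M.Dof k) : ℝ :=
  Real.sqrt (∑ T : M.cells, M.localEnergySq T.1 a (v.loc T))

/-- The norm of `v_h` in `L²(Ω)`. -/
def l2Norm (v : M.Dof k) : ℝ :=
  Real.sqrt (∫ x in Ω, (v.cellFun x) ^ 2)

end Mesh

end

end HHO

namespace HHO

noncomputable section

/-! ### Square-integrable vector fields and the Riesz representation -/

section Riesz

variable {X E : Type*} [MeasurableSpace X] {μ : Measure X}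
  [NormedAddCommGroup E] [InnerProductSpace ℝ E]

/-! The estimate is local to each cell `T`. The reaction term is nonnegative. Young's inequality
with weight `α` bounds the advection term below by `-(α/2) ‖∇R‖² - β²/(2α) ‖v_T‖²`. Since `∇R` is
the `L²`-projection of `G` onto gradients of polynomials of degree `k + 1`, `α ‖∇R‖² ≤ α ‖G‖² ≤
‖a^{1/2} G‖²`. So half of the diffusion and all of the stabilization survive, and it remains to
bound the jumps `v_F - v_T` by these two (`Mesh.localForm_ge`).

The jump is a face polynomial of degree `k`, hence fixed by `π_F`: it equals `S_F v + π_F δ` with `δ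
= R - π_T R`. An inverse estimate on balls (`exists_sup_le_l2`) and the mean value inequality give
`sup δ² ≤ C h_T^{2-d} ‖∇R‖²` on the closed cell (`exists_sq_sub_cellProj_le`), which replaces a
trace inequality. As `F` has measure at most `C h_F^{d-1}`, dividing by `h_F` leaves the factor
`(h_F / h_T)^{d-2} ≤ 1` (`exists_jump_le`).

Summing over faces needs a bound on their number. Each face of `T` contains a facet of a submesh
simplex in `T`, with a point on no other face; these simplices contain disjoint balls of radius `ϱ²
h_T`, so a volume count bounds them (`Mesh.IsRegular.card_facesOf_le`).

The operators are chosen by `Classical.epsilon`, so their defining equations require existence of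
solutions, obtained each time from `exists_integral_inner_eq`. -/

theorem inner_toLp_eq_integral {f g : X → E} (hf : MemLp f 2 μ) (hg : MemLp g 2 μ) :
    inner ℝ (hf.toLp f) (hg.toLp g) = ∫ x, inner ℝ (f x) (g x) ∂μ := by
  rw [L2.inner_def]
  refine integral_congr_ae ?_
  filter_upwards [hf.coeFn_toLp, hg.coeFn_toLp] with x h1 h2
  rw [h1, h2]

theorem integrable_inner_of_memLp_two {f g : X → E} (hf : MemLp f 2 μ) (hg : MemLp g 2 μ) :
    Integrable (fun x => inner ℝ (f x) (g x)) μ := by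
  refine (L2.integrable_inner (𝕜 := ℝ) (hf.toLp f) (hg.toLp g)).congr ?_
  filter_upwards [hf.coeFn_toLp, hg.coeFn_toLp] with x h1 h2
  rw [h1, h2]

/-- Cauchy–Schwarz for square-integrable functions. -/
theorem sq_integral_inner_le {f g : X → E} (hf : MemLp f 2 μ) (hg : MemLp g 2 μ) :
    (∫ x, inner ℝ (f x) (g x) ∂μ) ^ 2 ≤ (∫ x, ‖f x‖ ^ 2 ∂μ) * ∫ x, ‖g x‖ ^ 2 ∂μ := by
  have h := real_inner_mul_inner_self_le (hf.toLp f) (hg.toLp g)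
  simp only [inner_toLp_eq_integral, real_inner_self_eq_norm_sq] at h
  rw [← real_inner_self_eq_norm_sq, ← real_inner_self_eq_norm_sq, inner_toLp_eq_integral,
    inner_toLp_eq_integral] at h
  simpa only [real_inner_self_eq_norm_sq, sq] using h

/-- A linear functional on a finite-dimensional space `V` of square-integrable functions is
represented by an element of `V`, as soon as it vanishes on the null functions. -/
theorem exists_integral_inner_eq {V : Type*} [AddCommGroup V] [Module ℝ V]
    [FiniteDimensional ℝ V] (Φ : V →ₗ[ℝ] (X → E)) (hΦ : ∀ v, MemLp (Φ v) 2 μ)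
    (ℓ : V →ₗ[ℝ] ℝ) (hℓ : ∀ v, (∫ x, ‖Φ v x‖ ^ 2 ∂μ) = 0 → ℓ v = 0) :
    ∃ r : V, ∀ w : V, ∫ x, inner ℝ (Φ r x) (Φ w x) ∂μ = ℓ w := by
  have hi : ∀ v w, Integrable (fun x => inner ℝ (Φ v x) (Φ w x)) μ := fun v w =>
    integrable_inner_of_memLp_two (hΦ v) (hΦ w)
  let B : V →ₗ[ℝ] Module.Dual ℝ V := LinearMap.mk₂ ℝ
    (fun v w => ∫ x, inner ℝ (Φ v x) (Φ w x) ∂μ)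
    (fun v v' w => by
      simp only [map_add, Pi.add_apply, inner_add_left]
      exact integral_add (hi _ _) (hi _ _))
    (fun c v w => by
      simp only [map_smul, Pi.smul_apply, real_inner_smul_left, smul_eq_mul]
      exact integral_const_mul _ _)
    (fun v w w' => by
      simp only [map_add, Pi.add_apply, inner_add_right]
      exact integral_add (hi _ _) (hi _ _))
    (fun c v w => by
      simp only [map_smul, Pi.smul_apply, real_inner_smul_right, smul_eq_mul]
      exact integral_const_mul _ _)
  -- In finite dimension the range of `B` is the annihilator of its coannihilator, and a `w` in the
  -- latter has `B w w = 0`. The form may thus be degenerate, as it is for gradients, which kill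
  -- constants.
  have hmem : ℓ ∈ LinearMap.range B := by
    rw [← Subspace.dualCoannihilator_dualAnnihilator_eq (W := LinearMap.range B),
      Submodule.mem_dualAnnihilator]
    intro w hw
    refine hℓ w ?_
    have := (Submodule.mem_dualCoannihilator _).1 hw (B w) ⟨w, rfl⟩
    simpa [B] using this
  obtain ⟨r, hr⟩ := hmem
  exact ⟨r, fun w => by rw [← hr]; rfl⟩

end Riesz

/-! ### Polynomials -/

section Polynomials

variable {d : ℕ}

theorem continuous_ev (p : MvPolynomial (Fin d) ℝ) : Continuous (ev p) :=
  (MvPolynomial.continuous_eval p).comp (by fun_prop)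

theorem continuous_evVec (τ : Fin d → MvPolynomial (Fin d) ℝ) : Continuous (evVec τ) :=
  (PiLp.continuous_toLp 2 _).comp (continuous_pi fun i => continuous_ev (τ i))

@[simp] theorem ev_add (p q : MvPolynomial (Fin d) ℝ) (x : Euc d) :
    ev (p + q) x = ev p x + ev q x := by simp [ev]

@[simp] theorem ev_sub (p q : MvPolynomial (Fin d) ℝ) (x : Euc d) :
    ev (p - q) x = ev p x - ev q x := by simp [ev]

@[simp] theorem ev_smul (c : ℝ) (p : MvPolynomial (Fin d) ℝ) (x : Euc d) :
    ev (c • p) x = c * ev p x := by simp [ev]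

@[simp] theorem ev_C (c : ℝ) (x : Euc d) : ev (MvPolynomial.C c) x = c := by simp [ev]

@[simp] theorem ev_zero (x : Euc d) : ev (0 : MvPolynomial (Fin d) ℝ) x = 0 := by simp [ev]

theorem ev_sum {ι : Type*} (s : Finset ι) (p : ι → MvPolynomial (Fin d) ℝ) (x : Euc d) :
    ev (∑ i ∈ s, p i) x = ∑ i ∈ s, ev (p i) x := by simp [ev]

@[simp] theorem evVec_apply (τ : Fin d → MvPolynomial (Fin d) ℝ) (x : Euc d) (i : Fin d) :
    evVec τ x i = ev (τ i) x := rfl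

/-- An open set contains a box, a product of infinite sets, and only the zero polynomial vanishes on
such a product. -/
theorem ev_eq_zero_of_isOpen {U : Set (Euc d)} (hU : IsOpen U) (hne : U.Nonempty)
    {p : MvPolynomial (Fin d) ℝ} (h : ∀ x ∈ U, ev p x = 0) : p = 0 := by
  obtain ⟨x, hx⟩ := hne
  have hU' : IsOpen ((WithLp.toLp 2 : (Fin d → ℝ) → Euc d) ⁻¹' U) :=
    hU.preimage (PiLp.continuous_toLp 2 _)
  obtain ⟨ε, hε, hball⟩ := Metric.isOpen_iff.1 hU' (WithLp.ofLp x) (by simpa using hx)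
  refine MvPolynomial.funext_set (fun i => Metric.ball (x i) ε) (fun i => ?_) fun y hy => ?_
  · rw [Real.ball_eq_Ioo]
    exact Set.Ioo_infinite (by linarith)
  · have : y ∈ Metric.ball (WithLp.ofLp x) ε := by
      rw [ball_pi _ hε]; exact hy
    have := h _ (hball this)
    simpa [ev] using this

theorem totalDegree_pderiv_le (i : Fin d) {m : ℕ} {p : MvPolynomial (Fin d) ℝ}
    (hp : p.totalDegree ≤ m + 1) : (MvPolynomial.pderiv i p).totalDegree ≤ m := by
  conv_lhs => rw [p.as_sum, map_sum]
  refine MvPolynomial.totalDegree_finsetSum_le fun s hs => ?_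
  rw [MvPolynomial.pderiv_monomial]
  -- Truncated subtraction does not lower the exponent here, but the coefficient `s i` vanishes.
  by_cases hsi : s i = 0
  · simp [hsi]
  refine (MvPolynomial.totalDegree_monomial_le _ _).trans ?_
  have h1 : (s.sum fun _ => id) ≤ m + 1 := (MvPolynomial.le_totalDegree hs).trans hp
  have h2 : s = (s - Finsupp.single i 1) + Finsupp.single i 1 := by
    ext j
    by_cases hj : j = i
    · subst hj; simp; omega
    · simp [Ne.symm hj]
  rw [h2, Finsupp.sum_add_index' (by simp) (by simp)] at h1
  simpa using h1

/-- Makes `∇R` an admissible test field for `G`. -/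
theorem grad_mem_poly {m : ℕ} (p : Poly d (m + 1)) (i : Fin d) : grad p.1 i ∈ Poly d m :=
  (MvPolynomial.mem_restrictTotalDegree _ _ _).2
    (totalDegree_pderiv_le i ((MvPolynomial.mem_restrictTotalDegree _ _ _).1 p.2))

/-- Links the formal gradient with analysis; derivatives along lines suffice for the mean value
inequality. The induction on `p` reduces to the Leibniz rule for multiplication by a variable. -/
theorem hasDerivAt_ev_line (p : MvPolynomial (Fin d) ℝ) (c v : Euc d) (t : ℝ) :
    HasDerivAt (fun s : ℝ => ev p (c + s • v)) (inner ℝ (evVec (grad p) (c + t • v)) v) t := by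
  induction p using MvPolynomial.induction_on with
  | C r =>
    have : evVec (grad (MvPolynomial.C r)) (c + t • v) = 0 := by
      ext i; simp [grad]
    simpa [this] using hasDerivAt_const t r
  | add p q hp hq =>
    have : evVec (grad (p + q)) (c + t • v) =
        evVec (grad p) (c + t • v) + evVec (grad q) (c + t • v) := by
      ext i; simp [grad]
    rw [this, inner_add_left]
    simp only [ev_add]
    exact hp.add hq
  | mul_X p j hp =>
    have hX : HasDerivAt (fun s : ℝ => c j + s * v j) (v j) t := by
      simpa using ((hasDerivAt_id t).mul_const (v j)).const_add (c j)
    have := hp.mul hX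
    have e : (fun s : ℝ => ev (p * MvPolynomial.X j) (c + s • v)) =
        (fun s => ev p (c + s • v)) * fun s => c j + s * v j := by
      funext s; simp [ev]
    rw [e]
    refine this.congr_deriv (Eq.symm ?_)
    simp only [PiLp.inner_apply, evVec_apply, grad, Derivation.leibniz, MvPolynomial.pderiv_X,
      ev_add, RCLike.inner_apply, conj_trivial, smul_eq_mul]
    have e2 : ∀ i, ev (p * Pi.single (M := fun _ => MvPolynomial (Fin d) ℝ) i 1 j) (c + t • v)
        = if i = j then ev p (c + t • v) else 0 := by
      intro i
      by_cases h : i = j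
      · subst h; simp
      · rw [Pi.single_eq_of_ne (Ne.symm h)]; simp [h]
    simp only [e2, mul_add (v.ofLp _), Finset.sum_add_distrib]
    rw [add_comm]
    congr 1
    · rw [Finset.sum_mul]
      refine Finset.sum_congr rfl fun i _ => ?_
      simp [ev]
      ring
    · simp [mul_comm]

/-- Mean value inequality for polynomials on a ball. -/
theorem abs_ev_sub_le (p : MvPolynomial (Fin d) ℝ) {c : Euc d} {h D : ℝ}
    (hD : ∀ y ∈ Metric.closedBall c h, ‖evVec (grad p) y‖ ≤ D) {x : Euc d}
    (hx : x ∈ Metric.closedBall c h) : |ev p x - ev p c| ≤ D * h := by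
  have hxn : ‖x - c‖ ≤ h := by rwa [← dist_eq_norm]
  have hD0 : 0 ≤ D := (norm_nonneg _).trans (hD x hx)
  have key := (convex_Icc (0 : ℝ) 1).norm_image_sub_le_of_norm_hasDerivWithin_le
    (f := fun s : ℝ => ev p (c + s • (x - c)))
    (f' := fun t => inner ℝ (evVec (grad p) (c + t • (x - c))) (x - c)) (C := D * h)
    (fun t _ => (hasDerivAt_ev_line p c (x - c) t).hasDerivWithinAt)
    (fun t ht => ?_) (x := 0) (y := 1) (by simp) (by simp)
  · simpa using key
  · refine (norm_inner_le_norm _ _).trans ?_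
    refine mul_le_mul (hD _ ?_) hxn (norm_nonneg _) hD0
    rw [Metric.mem_closedBall, dist_eq_norm, add_sub_cancel_left, norm_smul]
    calc ‖t‖ * ‖x - c‖ ≤ 1 * ‖x - c‖ := by
          gcongr
          rw [Real.norm_of_nonneg ht.1]; exact ht.2
      _ ≤ h := by linarith

/-- The polynomial `x ↦ p (c + h x)`. -/
def rescale (c : Euc d) (h : ℝ) (p : MvPolynomial (Fin d) ℝ) : MvPolynomial (Fin d) ℝ :=
  MvPolynomial.aeval (fun i => MvPolynomial.C (c i) + MvPolynomial.C h * MvPolynomial.X i) p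

theorem ev_rescale (c : Euc d) (h : ℝ) (p : MvPolynomial (Fin d) ℝ) (x : Euc d) :
    ev (rescale c h p) x = ev p (c + h • x) := by
  induction p using MvPolynomial.induction_on with
  | C r => simp [rescale, ev]
  | add p q hp hq => rw [ev_add, ← hp, ← hq, ← ev_add, rescale, map_add]; rfl
  | mul_X p j hp =>
    have : ev (p * MvPolynomial.X j) (c + h • x) = ev p (c + h • x) * (c j + h * x j) := by
      simp [ev]
    rw [this, ← hp]
    simp [rescale, ev]

theorem totalDegree_rescale_le (c : Euc d) (h : ℝ) {m : ℕ} {p : MvPolynomial (Fin d) ℝ}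
    (hp : p.totalDegree ≤ m) : (rescale c h p).totalDegree ≤ m := by
  have hlin : ∀ i : Fin d, (MvPolynomial.C (c i) + MvPolynomial.C h * MvPolynomial.X i :
      MvPolynomial (Fin d) ℝ).totalDegree ≤ 1 := by
    intro i
    refine (MvPolynomial.totalDegree_add _ _).trans (max_le (by simp) ?_)
    refine (MvPolynomial.totalDegree_mul _ _).trans ?_
    simp
  rw [rescale, MvPolynomial.aeval_def, MvPolynomial.eval₂_eq]
  refine MvPolynomial.totalDegree_finsetSum_le fun s hs => ?_
  refine (MvPolynomial.totalDegree_mul _ _).trans ?_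
  rw [MvPolynomial.algebraMap_eq, MvPolynomial.totalDegree_C, zero_add]
  refine (MvPolynomial.totalDegree_finsetProd _ _).trans ?_
  have hs' : (s.sum fun _ => id) ≤ m := (MvPolynomial.le_totalDegree hs).trans hp
  refine le_trans (Finset.sum_le_sum fun i _ => ?_) hs'
  refine (MvPolynomial.totalDegree_pow _ _).trans ?_
  simpa using Nat.mul_le_mul_left (s i) (hlin i)

theorem isFiniteMeasure_restrict {T : Set (Euc d)} (hT : Bornology.IsBounded T) :
    IsFiniteMeasure (volume.restrict T) :=
  ⟨by rw [Measure.restrict_apply_univ]; exact hT.measure_lt_top⟩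

theorem memLp_two_of_continuous {E : Type*} [NormedAddCommGroup E] {f : Euc d → E}
    (hf : Continuous f) {T : Set (Euc d)} (hT : Bornology.IsBounded T) :
    MemLp f 2 (volume.restrict T) := by
  obtain ⟨C, hC⟩ := hT.isCompact_closure.exists_bound_of_continuousOn hf.continuousOn
  have := isFiniteMeasure_restrict hT
  refine MemLp.of_bound hf.aestronglyMeasurable C ?_
  refine ae_restrict_of_ae_restrict_of_subset subset_closure ?_
  exact (ae_restrict_iff' isClosed_closure.measurableSet).2 (Filter.Eventually.of_forall hC)

/-- Evaluation of polynomials, as a linear map. -/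
def evLin (d m : ℕ) : Poly d m →ₗ[ℝ] (Euc d → ℝ) where
  toFun p := ev p.1
  map_add' p q := by funext x; simp
  map_smul' c p := by funext x; simp

/-- A continuous function that vanishes almost everywhere on an open set vanishes there, so `L²(T)`
gives a genuine norm on polynomials. -/
theorem integral_sq_ev_eq_zero {T : Set (Euc d)} (hT : IsOpen T) (hne : T.Nonempty)
    (hb : Bornology.IsBounded T) {p : MvPolynomial (Fin d) ℝ}
    (h : ∫ x in T, (ev p x) ^ 2 = 0) : p = 0 := by
  refine ev_eq_zero_of_isOpen hT hne ?_
  have hint : Integrable (fun x => (ev p x) ^ 2) (volume.restrict T) := by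
    simpa using (memLp_two_of_continuous (continuous_ev p) hb).integrable_sq
  rw [integral_eq_zero_iff_of_nonneg (fun x => sq_nonneg _) hint] at h
  have h2 := Measure.eqOn_open_of_ae_eq (f := fun x => (ev p x) ^ 2) (g := fun _ => (0 : ℝ)) h hT
    ((continuous_ev p).pow 2).continuousOn continuousOn_const
  intro x hx
  exact pow_eq_zero_iff (two_ne_zero) |>.1 (h2 hx)

/-- Equivalence of norms in finite dimension, with an explicit constant: each coordinate functional
is an `L²` pairing with some `r i` on the small ball, and Cauchy–Schwarz applies to the sum over the
basis and to each pairing. -/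
theorem exists_sup_le_l2_unit (d m : ℕ) {ρ : ℝ} (hρ : 0 < ρ) :
    ∃ C : ℝ, 0 ≤ C ∧ ∀ q : Poly d m, ∀ x ∈ Metric.closedBall (0 : Euc d) 1,
      (ev q.1 x) ^ 2 ≤ C * ∫ y in Metric.ball (0 : Euc d) ρ, (ev q.1 y) ^ 2 := by
  let b := Module.finBasis ℝ (Poly d m)
  have hmem : ∀ q : Poly d m, MemLp (evLin d m q) 2 (volume.restrict (Metric.ball (0 : Euc d) ρ)) :=
    fun q => memLp_two_of_continuous (continuous_ev q.1) Metric.isBounded_ball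
  have hrep : ∀ i, ∃ r : Poly d m, ∀ w : Poly d m,
      ∫ x in Metric.ball (0 : Euc d) ρ, inner ℝ (evLin d m r x) (evLin d m w x) = b.coord i w := by
    intro i
    refine exists_integral_inner_eq _ hmem _ fun v hv => ?_
    have : v.1 = 0 := integral_sq_ev_eq_zero Metric.isOpen_ball (Metric.nonempty_ball.2 hρ)
      Metric.isBounded_ball (by simpa [evLin] using hv)
    have : v = 0 := Subtype.ext this
    simp [this]
  choose r hr using hrep
  have hbd : ∀ i, ∃ M : ℝ, ∀ x ∈ Metric.closedBall (0 : Euc d) 1, ‖ev (b i).1 x‖ ≤ M := fun i =>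
    (isCompact_closedBall (0 : Euc d) 1).exists_bound_of_continuousOn
      (continuous_ev (b i).1).continuousOn
  choose M hM using hbd
  refine ⟨(∑ i, M i ^ 2) * ∑ i, ∫ x in Metric.ball (0 : Euc d) ρ, ‖evLin d m (r i) x‖ ^ 2,
    mul_nonneg (Finset.sum_nonneg fun _ _ => sq_nonneg _)
      (Finset.sum_nonneg fun _ _ => integral_nonneg fun _ => sq_nonneg _), fun q x hx => ?_⟩
  have hq : ev q.1 x = ∑ i, ev (b i).1 x * b.coord i q := by
    have h := congrArg (fun p : Poly d m => ev p.1 x) (b.sum_repr q)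
    simp only [Submodule.coe_sum, ev_sum, Submodule.coe_smul, ev_smul] at h
    rw [← h]
    exact Finset.sum_congr rfl fun i _ => mul_comm _ _
  rw [hq]
  refine (Finset.sum_mul_sq_le_sq_mul_sq _ _ _).trans ?_
  rw [mul_assoc]
  refine mul_le_mul (Finset.sum_le_sum fun i _ => ?_) ?_
    (Finset.sum_nonneg fun _ _ => sq_nonneg _) (Finset.sum_nonneg fun _ _ => sq_nonneg _)
  · rw [← sq_abs]
    exact pow_le_pow_left₀ (abs_nonneg _) (hM i x hx) 2
  · rw [Finset.sum_mul]
    refine Finset.sum_le_sum fun i _ => ?_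
    rw [← hr i q]
    simpa [evLin] using sq_integral_inner_le (hmem (r i)) (hmem q)

theorem setIntegral_ball_comp_affine (f : Euc d → ℝ) (c : Euc d) {h ρ : ℝ} (hh : 0 < h) :
    ∫ y in Metric.ball (0 : Euc d) ρ, f (c + h • y) =
      (h ^ d)⁻¹ * ∫ y in Metric.ball c (ρ * h), f y := by
  have h1 := Measure.setIntegral_comp_smul_of_pos (volume : Measure (Euc d))
    (fun y => f (c + y)) (Metric.ball (0 : Euc d) ρ) hh
  rw [h1, smul_ball hh.ne', smul_zero, Real.norm_of_nonneg hh.le, finrank_euclideanSpace,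
    Fintype.card_fin, smul_eq_mul, mul_comm h ρ]
  congr 1
  have h2 := (measurePreserving_add_left (volume : Measure (Euc d)) c).setIntegral_preimage_emb
    (measurableEmbedding_addLeft c) f (Metric.ball c (ρ * h))
  rw [← h2]
  have h3 : (fun y => c + y) ⁻¹' Metric.ball c (ρ * h) = Metric.ball (0 : Euc d) (ρ * h) := by
    ext y
    simp [Metric.mem_ball, dist_eq_norm]
  rw [h3]

/-- Inverse estimate for polynomials: the maximum on a ball is controlled by the mean square on a
smaller concentric ball. -/
theorem exists_sup_le_l2 (d m : ℕ) {ρ : ℝ} (hρ : 0 < ρ) :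
    ∃ C : ℝ, 0 ≤ C ∧ ∀ (c : Euc d) (h : ℝ), 0 < h → ∀ q : Poly d m,
      ∀ x ∈ Metric.closedBall c h,
      (ev q.1 x) ^ 2 ≤ C * (h ^ d)⁻¹ * ∫ y in Metric.ball c (ρ * h), (ev q.1 y) ^ 2 := by
  obtain ⟨C, hC, H⟩ := exists_sup_le_l2_unit d m hρ
  refine ⟨C, hC, fun c h hh q x hx => ?_⟩
  have hq' : rescale c h q.1 ∈ Poly d m := (MvPolynomial.mem_restrictTotalDegree _ _ _).2
    (totalDegree_rescale_le c h ((MvPolynomial.mem_restrictTotalDegree _ _ _).1 q.2))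
  -- The unit-ball estimate is applied to `q (c + h ·)` at this point; the Jacobian produces `(h ^
  -- d)⁻¹`.
  have hx' : h⁻¹ • (x - c) ∈ Metric.closedBall (0 : Euc d) 1 := by
    rw [mem_closedBall_zero_iff, norm_smul, norm_inv, Real.norm_of_nonneg hh.le,
      inv_mul_le_iff₀ hh, mul_one, ← dist_eq_norm]
    exact hx
  have key := H ⟨_, hq'⟩ _ hx'
  simp only [ev_rescale] at key
  rw [smul_inv_smul₀ hh.ne', add_sub_cancel] at key
  refine key.trans_eq ?_
  rw [mul_assoc]
  congr 1
  exact setIntegral_ball_comp_affine (fun y => (ev q.1 y) ^ 2) c hh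

end Polynomials

/-! ### Cells -/

section Cells

variable {d : ℕ} {Ω : Set (Euc d)}

theorem IsOpenPolyhedron.exists_eq_interior {T : Set (Euc d)} (h : IsOpenPolyhedron T) :
    ∃ A : Set (Euc d), IsCompact A ∧ T = interior A := by
  obtain ⟨S, -, rfl⟩ := h
  exact ⟨_, S.finite_toSet.isCompact_biUnion fun s _ => s.finite_toSet.isCompact_convexHull ℝ, rfl⟩

theorem IsOpenPolyhedron.isOpen {T : Set (Euc d)} (h : IsOpenPolyhedron T) : IsOpen T := by
  obtain ⟨A, -, rfl⟩ := h.exists_eq_interior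
  exact isOpen_interior

theorem IsOpenPolyhedron.isBounded {T : Set (Euc d)} (h : IsOpenPolyhedron T) :
    Bornology.IsBounded T := by
  obtain ⟨A, hA, rfl⟩ := h.exists_eq_interior
  exact hA.isBounded.subset interior_subset

/-- Excludes slits: a cell whose closure fills a neighbourhood of a point contains that point. -/
theorem IsOpenPolyhedron.interior_closure {T : Set (Euc d)} (h : IsOpenPolyhedron T) :
    interior (closure T) = T := by
  obtain ⟨A, hA, rfl⟩ := h.exists_eq_interior
  exact (interior_mono hA.isClosed.closure_interior_subset).antisymm
    (interior_maximal subset_closure isOpen_interior)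

theorem Mesh.subset_frontier_of_mem_facesOf (M : Mesh Ω) {T F : Set (Euc d)}
    (h : F ∈ M.facesOf T) : F ⊆ frontier T := by
  classical
  unfold Mesh.facesOf at h
  exact (Finset.mem_filter.mp h).2

/-- Boundedness comes from `face_cover`: a face lies in the union of the frontiers of finitely many
bounded cells. -/
theorem Mesh.isCompact_face (M : Mesh Ω) {F : Set (Euc d)} (h : F ∈ M.faces) : IsCompact F := by
  have hb : Bornology.IsBounded (⋃ T ∈ M.cells, frontier T) :=
    (Bornology.isBounded_biUnion M.cells.finite_toSet).2 fun T hT =>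
      (M.cell_polyhedron T hT).isBounded.closure.subset frontier_subset_closure
  rw [M.face_cover] at hb
  exact Metric.isCompact_of_isClosed_isBounded (M.face_closed F h)
    (hb.subset (subset_biUnion_of_mem (u := fun F => F) h))

end Cells

/-! ### Surface measure -/

section Surface

variable {d : ℕ} {Ω : Set (Euc d)}

/-- Centred at one of its points, `F` lies in an isometric copy of the ball of radius `diam F` in
`ℝ^{d-1}`, and the measure is invariant under isometries. -/
theorem euclideanHausdorffMeasure_le_of_subset_hyperplane (hd : 1 ≤ d) {n : Euc d} (hn : ‖n‖ = 1)
    {o : ℝ} {F : Set (Euc d)} (hF : ∀ x ∈ F, inner ℝ n x = o) (hb : Bornology.IsBounded F) :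
    (μHE[d - 1] : Measure (Euc d)) F ≤ ENNReal.ofReal (Metric.diam F ^ (d - 1)) *
      volume (Metric.closedBall (0 : Euc (d - 1)) 1) := by
  rcases F.eq_empty_or_nonempty with rfl | ⟨p, hp⟩
  · simp
  let V : Submodule ℝ (Euc d) := (ℝ ∙ n)ᗮ
  have hV : Module.finrank ℝ V = d - 1 := by
    have : Fact (Module.finrank ℝ (Euc d) = (d - 1) + 1) := ⟨by simp; omega⟩
    exact Submodule.finrank_orthogonal_span_singleton (by
      intro h; simp [h] at hn)
  rw [← hV]
  let e := (stdOrthonormalBasis ℝ V).repr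
  let g : EuclideanSpace ℝ (Fin (Module.finrank ℝ V)) → Euc d := fun z => p + (e.symm z : Euc d)
  have hg : Isometry g := by
    refine Isometry.of_dist_eq fun z w => ?_
    simp only [g, dist_add_left]
    exact e.symm.isometry.dist_eq z w
  have hsub : F ⊆ g '' Metric.closedBall 0 (Metric.diam F) := by
    intro x hx
    have hxV : x - p ∈ V := by
      rw [Submodule.mem_orthogonal_singleton_iff_inner_right, inner_sub_right, hF x hx, hF p hp,
        sub_self]
    refine ⟨e ⟨x - p, hxV⟩, ?_, by simp [g]⟩
    rw [mem_closedBall_zero_iff, e.norm_map, Submodule.coe_norm, ← dist_eq_norm]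
    exact Metric.dist_le_diam_of_mem hb hx hp
  refine (measure_mono hsub).trans ?_
  rw [hg.euclideanHausdorffMeasure_image, EuclideanSpace.euclideanHausdorffMeasure_eq_volume,
    Measure.addHaar_closedBall _ _ Metric.diam_nonneg, finrank_euclideanSpace, Fintype.card_fin,
    Measure.addHaar_unitClosedBall_eq_addHaar_unitBall]

/-- Measure of the unit ball of `ℝ^{d-1}`. -/
def faceConst (d : ℕ) : ℝ := (volume : Measure (Euc (d - 1))).real (Metric.closedBall 0 1)

theorem surf_univ (F : Set (Euc d)) (hF : IsClosed F) :
    surf F univ = (μHE[d - 1] : Measure (Euc d)) F := by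
  rw [surf, (MeasurableEmbedding.subtype_coe hF.measurableSet).comap_apply]
  simp

theorem Mesh.surf_univ_le (M : Mesh Ω) (hd : 1 ≤ d) {F : Set (Euc d)} (h : F ∈ M.faces) :
    surf F univ ≤ ENNReal.ofReal (Metric.diam F ^ (d - 1)) *
      volume (Metric.closedBall (0 : Euc (d - 1)) 1) := by
  rw [surf_univ F (M.face_closed F h)]
  exact euclideanHausdorffMeasure_le_of_subset_hyperplane hd (M.faceNormal_unit F h)
    (M.face_hyperplane F h) (M.isCompact_face h).isBounded

theorem Mesh.isFiniteMeasure_surf (M : Mesh Ω) (hd : 1 ≤ d) {F : Set (Euc d)} (h : F ∈ M.faces) :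
    IsFiniteMeasure (surf F) :=
  ⟨(M.surf_univ_le hd h).trans_lt (ENNReal.mul_lt_top ENNReal.ofReal_lt_top
    (isCompact_closedBall _ _).measure_lt_top)⟩

theorem Mesh.surf_real_univ_le (M : Mesh Ω) (hd : 1 ≤ d) {F : Set (Euc d)} (h : F ∈ M.faces) :
    (surf F).real univ ≤ Metric.diam F ^ (d - 1) * faceConst d := by
  have h1 := ENNReal.toReal_mono (ENNReal.mul_lt_top ENNReal.ofReal_lt_top
    (isCompact_closedBall _ _).measure_lt_top).ne (M.surf_univ_le hd h)
  rwa [ENNReal.toReal_mul, ENNReal.toReal_ofReal (pow_nonneg Metric.diam_nonneg _)] at h1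

theorem Mesh.memLp_surf (M : Mesh Ω) (hd : 1 ≤ d) {F : Set (Euc d)} (h : F ∈ M.faces)
    {E : Type*} [NormedAddCommGroup E] {f : F → E} (hf : Continuous f) :
    MemLp f 2 (surf F) := by
  have := M.isFiniteMeasure_surf hd h
  have : CompactSpace F := isCompact_iff_compactSpace.1 (M.isCompact_face h)
  obtain ⟨C, hC⟩ := (isCompact_univ (X := F)).exists_bound_of_continuousOn hf.continuousOn
  exact MemLp.of_bound hf.aestronglyMeasurable C (Filter.Eventually.of_forall fun x => hC x trivial)

theorem continuous_facePoly {k : ℕ} {F : Set (Euc d)} (q : FacePoly k F) : Continuous q.1 := by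
  obtain ⟨q, p, -, rfl⟩ := q
  exact (continuous_ev p).comp continuous_subtype_val

/-- With measurability, this is all that is needed of the normal: the face integrals in `reconRhs`
converge, so `reconRhs` is linear in the test field. -/
theorem Mesh.norm_normal_le (M : Mesh Ω) {T F : Set (Euc d)} (h : F ∈ M.faces) (x : Euc d) :
    ‖M.normal T F x‖ ≤ 1 := by
  unfold Mesh.normal
  split_ifs <;> simp [M.faceNormal_unit F h]

/-- The set where a property holds in a neighbourhood is an interior, hence open. -/
theorem Mesh.measurable_normal (M : Mesh Ω) (T F : Set (Euc d)) : Measurable (M.normal T F) := by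
  have h : ∀ P : Euc d → Prop, MeasurableSet {x | ∀ᶠ y in nhds x, P y} := fun P => by
    have : {x | ∀ᶠ y in nhds x, P y} = interior {y | P y} := by
      ext x; rw [mem_interior_iff_mem_nhds]; rfl
    rw [this]; exact isOpen_interior.measurableSet
  classical
  unfold Mesh.normal
  refine Measurable.ite (h _) measurable_const (Measurable.ite (h _) measurable_const
    measurable_const)

theorem Mesh.memLp_inner_normal (M : Mesh Ω) (hd : 1 ≤ d) {T F : Set (Euc d)} (h : F ∈ M.faces)
    (τ : Fin d → MvPolynomial (Fin d) ℝ) :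
    MemLp (fun x : F => inner ℝ (evVec τ x) (M.normal T F x)) 2 (surf F) := by
  have h1 := M.memLp_surf hd h ((continuous_evVec τ).comp continuous_subtype_val)
  refine h1.of_le ?_ (Filter.Eventually.of_forall fun x => ?_)
  · exact h1.aestronglyMeasurable.inner
      ((M.measurable_normal T F).comp measurable_subtype_coe).aestronglyMeasurable
  · refine (norm_inner_le_norm _ _).trans ?_
    exact mul_le_of_le_one_right (norm_nonneg _) (M.norm_normal_le h _)

theorem Mesh.integrable_jump_mul_inner_normal (M : Mesh Ω) (hd : 1 ≤ d) {k : ℕ} {T : Set (Euc d)}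
    (v : M.LocalDof k T) (F : M.facesOf T) (τ : Fin d → MvPolynomial (Fin d) ℝ) :
    Integrable (fun x : F.1 => ((v.2 F).1 x - ev v.1.1 x) *
      inner ℝ (evVec τ x) (M.normal T F.1 x)) (surf F.1) := by
  have hF := M.mem_faces_of_mem_facesOf F.2
  exact (M.memLp_surf hd hF ((continuous_facePoly _).sub
    ((continuous_ev _).comp continuous_subtype_val))).integrable_mul
    (M.memLp_inner_normal hd hF τ)

end Surface

/-! ### The discrete operators are well defined -/

section WellDefined

variable {d k : ℕ} {Ω : Set (Euc d)} (M : Mesh Ω) {T : Set (Euc d)}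

theorem evVec_add (τ σ : Fin d → MvPolynomial (Fin d) ℝ) (x : Euc d) :
    evVec (τ + σ) x = evVec τ x + evVec σ x := by
  ext i; simp

theorem evVec_smul (c : ℝ) (τ : Fin d → MvPolynomial (Fin d) ℝ) (x : Euc d) :
    evVec (c • τ) x = c • evVec τ x := by
  ext i; simp

theorem Mesh.reconRhs_add (hd : 1 ≤ d) (hb : Bornology.IsBounded T) (v : M.LocalDof k T)
    (τ σ : Fin d → MvPolynomial (Fin d) ℝ) :
    M.reconRhs T v (τ + σ) = M.reconRhs T v τ + M.reconRhs T v σ := by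
  have hm := fun τ => memLp_two_of_continuous (continuous_evVec (d := d) τ) hb
  simp only [Mesh.reconRhs, evVec_add, inner_add_left, inner_add_right, mul_add]
  rw [integral_add (integrable_inner_of_memLp_two (hm _) (hm _))
    (integrable_inner_of_memLp_two (hm _) (hm _)), add_add_add_comm, ← Finset.sum_add_distrib]
  congr 1
  refine Finset.sum_congr rfl fun F _ => ?_
  exact integral_add (M.integrable_jump_mul_inner_normal hd v F τ)
    (M.integrable_jump_mul_inner_normal hd v F σ)

theorem Mesh.reconRhs_smul (v : M.LocalDof k T) (c : ℝ) (τ : Fin d → MvPolynomial (Fin d) ℝ) :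
    M.reconRhs T v (c • τ) = c * M.reconRhs T v τ := by
  simp only [Mesh.reconRhs, evVec_smul, real_inner_smul_left, real_inner_smul_right, mul_add,
    Finset.mul_sum]
  rw [integral_const_mul]
  congr 1
  refine Finset.sum_congr rfl fun F _ => ?_
  rw [← integral_const_mul]
  congr 1
  funext x
  ring

theorem evVec_eq_zero_of_integral (hT : IsOpen T) (hne : T.Nonempty)
    (hb : Bornology.IsBounded T) {τ : Fin d → MvPolynomial (Fin d) ℝ}
    (h : ∫ x in T, ‖evVec τ x‖ ^ 2 = 0) : τ = 0 := by
  funext i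
  refine integral_sq_ev_eq_zero hT hne hb (le_antisymm ?_ (integral_nonneg fun _ => sq_nonneg _))
  rw [← h]
  refine integral_mono_of_nonneg (Filter.Eventually.of_forall fun _ => sq_nonneg _) ?_
    (Filter.Eventually.of_forall fun x => ?_)
  · exact (memLp_two_of_continuous (continuous_evVec τ) hb).integrable_norm_pow (by norm_num)
  · simp only [EuclideanSpace.norm_sq_eq, evVec_apply, Real.norm_eq_abs, sq_abs]
    exact Finset.single_le_sum (f := fun i => ev (τ i) x ^ 2) (fun _ _ => sq_nonneg _)
      (Finset.mem_univ i)

theorem Mesh.reconRhs_zero (v : M.LocalDof k T) : M.reconRhs T v 0 = 0 := by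
  simpa using M.reconRhs_smul v 0 0

/-- A test field of zero norm is the zero field on an open cell, so the representation lemma
provides a solution. -/
theorem Mesh.gradRecon_spec (hd : 1 ≤ d) (hT : T ∈ M.cells) (v : M.LocalDof k T)
    (τ : Fin d → Poly d k) :
    ∫ x in T, inner ℝ (M.G T v x) (evVec (fun i => (τ i).1) x) =
      M.reconRhs T v (fun i => (τ i).1) := by
  have hTo := M.cell_polyhedron T hT
  have hex : ∃ g : Fin d → Poly d k, ∀ τ : Fin d → Poly d k,
      ∫ x in T, inner ℝ (evVec (fun i => (g i).1) x) (evVec (fun i => (τ i).1) x) =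
        M.reconRhs T v (fun i => (τ i).1) := by
    let Φ : (Fin d → Poly d k) →ₗ[ℝ] (Euc d → Euc d) :=
      { toFun := fun τ => evVec fun i => (τ i).1
        map_add' := fun τ σ => funext fun x => evVec_add (fun i => (τ i).1) (fun i => (σ i).1) x
        map_smul' := fun c τ => funext fun x => evVec_smul c (fun i => (τ i).1) x }
    let ℓ : (Fin d → Poly d k) →ₗ[ℝ] ℝ :=
      { toFun := fun τ => M.reconRhs T v fun i => (τ i).1
        map_add' := fun τ σ => M.reconRhs_add hd hTo.isBounded v _ _
        map_smul' := fun c τ => M.reconRhs_smul v c _ }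
    refine exists_integral_inner_eq Φ
      (fun τ => memLp_two_of_continuous (continuous_evVec _) hTo.isBounded) ℓ fun τ hτ => ?_
    have : (fun i => (τ i).1) = 0 :=
      evVec_eq_zero_of_integral hTo.isOpen (M.cell_nonempty T hT) hTo.isBounded hτ
    change M.reconRhs T v (fun i => (τ i).1) = 0
    rw [this, M.reconRhs_zero]
  exact Classical.epsilon_spec hex τ

/-- The gradient pairing is degenerate on constants, but `reconRhs` sees only `grad w` and so
vanishes on them too. -/
theorem Mesh.potRecon_spec (hd : 1 ≤ d) (hT : T ∈ M.cells) (v : M.LocalDof k T)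
    (w : Poly d (k + 1)) :
    ∫ x in T, inner ℝ (M.gradR T v x) (evVec (grad w.1) x) = M.reconRhs T v (grad w.1) := by
  have hTo := M.cell_polyhedron T hT
  have hgradadd : ∀ p q : MvPolynomial (Fin d) ℝ, grad (p + q) = grad p + grad q := fun p q => by
    funext i; simp [grad]
  have hgradsmul : ∀ (c : ℝ) (p : MvPolynomial (Fin d) ℝ), grad (c • p) = c • grad p :=
    fun c p => by funext i; simp [grad]
  have hex : ∃ r : Poly d (k + 1), (∀ w : Poly d (k + 1),
      ∫ x in T, inner ℝ (evVec (grad r.1) x) (evVec (grad w.1) x) = M.reconRhs T v (grad w.1)) ∧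
      ∫ x in T, ev r.1 x = ∫ x in T, ev v.1.1 x := by
    let Φ : Poly d (k + 1) →ₗ[ℝ] (Euc d → Euc d) :=
      { toFun := fun w => evVec (grad w.1)
        map_add' := fun p q => funext fun x => by
          rw [Submodule.coe_add, hgradadd, evVec_add]; rfl
        map_smul' := fun c p => funext fun x => by
          rw [Submodule.coe_smul, hgradsmul, evVec_smul]; rfl }
    let ℓ : Poly d (k + 1) →ₗ[ℝ] ℝ :=
      { toFun := fun w => M.reconRhs T v (grad w.1)
        map_add' := fun p q => by
          rw [Submodule.coe_add, hgradadd, M.reconRhs_add hd hTo.isBounded]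
        map_smul' := fun c p => by
          rw [Submodule.coe_smul, hgradsmul, M.reconRhs_smul]; rfl }
    obtain ⟨r, hr⟩ := exists_integral_inner_eq Φ
      (fun w => memLp_two_of_continuous (continuous_evVec _) hTo.isBounded) ℓ fun w hw => by
        have : grad w.1 = 0 :=
          evVec_eq_zero_of_integral hTo.isOpen (M.cell_nonempty T hT) hTo.isBounded hw
        change M.reconRhs T v (grad w.1) = 0
        rw [this, M.reconRhs_zero]
    have hvol : volume.real T ≠ 0 := (ENNReal.toReal_pos
      (hTo.isOpen.measure_pos volume (M.cell_nonempty T hT)).ne'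
      hTo.isBounded.measure_lt_top.ne).ne'
    have := isFiniteMeasure_restrict hTo.isBounded
    have hint : Integrable (ev r.1) (volume.restrict T) :=
      (memLp_two_of_continuous (continuous_ev r.1) hTo.isBounded).integrable (by norm_num)
    -- Adding this constant adjusts the mean of `r` and leaves its gradient unchanged. The mean
    -- condition must also be met before `Classical.epsilon_spec` applies.
    set c : ℝ := ((∫ x in T, ev v.1.1 x) - ∫ x in T, ev r.1 x) / volume.real T with hc
    have hCmem : MvPolynomial.C c ∈ Poly d (k + 1) :=
      (MvPolynomial.mem_restrictTotalDegree _ _ _).2 (by simp)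
    refine ⟨r + ⟨_, hCmem⟩, fun w => ?_, ?_⟩
    · have : grad (r + ⟨_, hCmem⟩ : Poly d (k + 1)).1 = grad r.1 := by
        rw [Submodule.coe_add, hgradadd]
        funext i
        simp [grad]
      rw [this]
      exact hr w
    · simp only [Submodule.coe_add, ev_add, ev_C]
      rw [integral_add hint (integrable_const _), setIntegral_const, smul_eq_mul, hc,
        mul_div_cancel₀ _ hvol]
      ring
  exact (Classical.epsilon_spec hex).1 w

theorem Mesh.cellProj_spec (m : ℕ) (hT : T ∈ M.cells) {f : Euc d → ℝ} (hf : Continuous f)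
    (w : Poly d m) :
    ∫ x in T, ev (cellProj m T f).1 x * ev w.1 x = ∫ x in T, f x * ev w.1 x := by
  have hTo := M.cell_polyhedron T hT
  have hm := fun w : Poly d m => memLp_two_of_continuous (continuous_ev w.1) hTo.isBounded
  have hmf := memLp_two_of_continuous hf hTo.isBounded
  have hex : ∃ q : Poly d m, ∀ w : Poly d m,
      ∫ x in T, ev q.1 x * ev w.1 x = ∫ x in T, f x * ev w.1 x := by
    let ℓ : Poly d m →ₗ[ℝ] ℝ :=
      { toFun := fun w => ∫ x in T, f x * ev w.1 x
        map_add' := fun p q => by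
          simp only [Submodule.coe_add, ev_add, mul_add]
          exact integral_add (hmf.integrable_mul (hm p)) (hmf.integrable_mul (hm q))
        map_smul' := fun c p => by
          simp only [Submodule.coe_smul, ev_smul, mul_left_comm (f _) c]
          exact integral_const_mul _ _ }
    obtain ⟨r, hr⟩ := exists_integral_inner_eq (evLin d m) hm ℓ fun w hw => by
      have : w.1 = 0 := integral_sq_ev_eq_zero hTo.isOpen (M.cell_nonempty T hT) hTo.isBounded
        (by simpa [evLin] using hw)
      simp [ℓ, this]
    refine ⟨r, fun w => ?_⟩
    rw [← show ℓ w = ∫ x in T, f x * ev w.1 x from rfl, ← hr w]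
    simp [evLin, mul_comm]
  exact Classical.epsilon_spec hex w

theorem Mesh.faceProj_spec (m : ℕ) (hd : 1 ≤ d) {F : Set (Euc d)} (hF : F ∈ M.faces) {f : F → ℝ}
    (hf : Continuous f) (w : FacePoly m F) :
    ∫ x, (faceProj m F f).1 x * w.1 x ∂(surf F) = ∫ x, f x * w.1 x ∂(surf F) := by
  have hm := fun w : FacePoly m F => M.memLp_surf hd hF (continuous_facePoly w)
  have hmf := M.memLp_surf hd hF hf
  have : FiniteDimensional ℝ (FacePoly m F) := by unfold FacePoly; infer_instance
  have hex : ∃ q : FacePoly m F, ∀ w : FacePoly m F,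
      ∫ x, q.1 x * w.1 x ∂(surf F) = ∫ x, f x * w.1 x ∂(surf F) := by
    let ℓ : FacePoly m F →ₗ[ℝ] ℝ :=
      { toFun := fun w => ∫ x, f x * w.1 x ∂(surf F)
        map_add' := fun p q => by
          simp only [Submodule.coe_add, Pi.add_apply, mul_add]
          exact integral_add (hmf.integrable_mul (hm p)) (hmf.integrable_mul (hm q))
        map_smul' := fun c p => by
          simp only [Submodule.coe_smul, Pi.smul_apply, smul_eq_mul, mul_left_comm (f _) c]
          exact integral_const_mul _ _ }
    obtain ⟨r, hr⟩ := exists_integral_inner_eq (FacePoly m F).subtype hm ℓ fun w hw => by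
      -- No definiteness on the face is needed: by Cauchy–Schwarz the functional vanishes on every
      -- null `w`.
      have h2 := sq_integral_inner_le (hm w) hmf
      rw [show ∫ x, ‖w.1 x‖ ^ 2 ∂(surf F) = 0 from hw, zero_mul] at h2
      have h3 := pow_eq_zero_iff two_ne_zero |>.1 (le_antisymm h2 (sq_nonneg _))
      simpa [ℓ] using h3
    refine ⟨r, fun w => ?_⟩
    rw [← show ℓ w = ∫ x, f x * w.1 x ∂(surf F) from rfl, ← hr w]
    simp [mul_comm]
  exact Classical.epsilon_spec hex w

end WellDefined

/-! ### Simplicial complexes -/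

section Complex

variable {d : ℕ}

theorem affineMap_eq_zero_of_mem_convexHull {f : Euc d →ᵃ[ℝ] ℝ} {S : Set (Euc d)}
    (h : ∀ v ∈ S, f v = 0) {x : Euc d} (hx : x ∈ convexHull ℝ S) : f x = 0 := by
  have hc : Convex ℝ (f ⁻¹' {0}) := (convex_singleton (0 : ℝ)).affine_preimage f
  exact convexHull_min (fun v hv => h v hv) hc hx

/-- The affine basis formed by the vertices of a nondegenerate simplex. -/
def simplexBasis {t : Finset (Euc d)} (ht : AffineIndependent ℝ ((↑) : t → Euc d))
    (hc : t.card = d + 1) : AffineBasis t ℝ (Euc d) :=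
  ⟨Subtype.val, ht, ht.affineSpan_eq_top_iff_card_eq_finrank_add_one.2 (by simpa using hc)⟩

section Basis

variable {t : Finset (Euc d)} (ht : AffineIndependent ℝ ((↑) : t → Euc d)) (hc : t.card = d + 1)

theorem range_simplexBasis : range (simplexBasis ht hc) = (t : Set (Euc d)) :=
  Subtype.range_coe

theorem mem_convexHull_iff_coord {x : Euc d} :
    x ∈ convexHull ℝ (t : Set (Euc d)) ↔ ∀ v, 0 ≤ (simplexBasis ht hc).coord v x := by
  rw [← range_simplexBasis ht hc, AffineBasis.convexHull_eq_nonneg_coord]; rfl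

theorem mem_interior_convexHull_iff_coord {x : Euc d} :
    x ∈ interior (convexHull ℝ (t : Set (Euc d))) ↔
      ∀ v, 0 < (simplexBasis ht hc).coord v x := by
  rw [← range_simplexBasis ht hc, AffineBasis.interior_convexHull]; rfl

theorem coord_simplexBasis_of_ne {v : t} {w : Euc d} (hw : w ∈ t) (h : w ≠ v) :
    (simplexBasis ht hc).coord v w = 0 :=
  (simplexBasis ht hc).coord_apply_ne (i := v) (j := ⟨w, hw⟩) fun e =>
    h (congrArg Subtype.val e).symm

theorem coord_simplexBasis_self (v : t) : (simplexBasis ht hc).coord v v = 1 :=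
  (simplexBasis ht hc).coord_apply_eq v

theorem continuous_coord_simplexBasis (v : t) : Continuous ((simplexBasis ht hc).coord v) :=
  AffineMap.continuous_of_finiteDimensional _

theorem coord_eq_zero_of_mem_convexHull {S : Set (Euc d)} (hS : S ⊆ t) {v : t} (hv : v.1 ∉ S)
    {x : Euc d} (hx : x ∈ convexHull ℝ S) : (simplexBasis ht hc).coord v x = 0 :=
  affineMap_eq_zero_of_mem_convexHull
    (fun _ hw => coord_simplexBasis_of_ne ht hc (hS hw) fun e => hv (e ▸ hw)) hx

/-- An affine function is the barycentric combination of its vertex values, and only the one at `p`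
survives. It transfers the sign relative to the hyperplane of a facet between the two simplices
adjacent to it. -/
theorem eq_coord_mul {f : Euc d →ᵃ[ℝ] ℝ} {p : t} (hf : ∀ v ∈ t, v ≠ p → f v = 0) (x : Euc d) :
    f x = (simplexBasis ht hc).coord p x * f p := by
  set b := simplexBasis ht hc
  conv_lhs => rw [← b.affineCombination_coord_eq_self x,
    Finset.map_affineCombination _ _ _ (b.sum_coord_apply_eq_one x),
    Finset.affineCombination_eq_linear_combination _ _ _ (b.sum_coord_apply_eq_one x)]
  rw [Finset.sum_eq_single p]
  · rfl
  · intro v _ hv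
    have : f v = 0 := hf v v.2 fun e => hv (Subtype.ext e)
    change b.coord v x • f v = 0
    rw [this, smul_zero]
  · simp

theorem mem_convexHull_erase_of_coord_eq_zero {x : Euc d}
    (hx : x ∈ convexHull ℝ (t : Set (Euc d))) {v : t}
    (hv : (simplexBasis ht hc).coord v x = 0) :
    x ∈ convexHull ℝ ((t.erase v : Finset (Euc d)) : Set (Euc d)) := by
  classical
  set b := simplexBasis ht hc
  have h1 := b.sum_coord_apply_eq_one x
  have h2 := b.linear_combination_coord_eq_self x
  rw [← Finset.sum_erase Finset.univ (a := v) hv] at h1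
  rw [← Finset.sum_erase Finset.univ (a := v) (by simp [hv])] at h2
  rw [← h2]
  refine (convex_convexHull ℝ _).sum_mem (fun w _ => (mem_convexHull_iff_coord ht hc).1 hx w) h1
    fun w hw => subset_convexHull ℝ _ ?_
  have hne : w ≠ v := Finset.ne_of_mem_erase hw
  exact Finset.mem_coe.2 (Finset.mem_erase.2 ⟨fun e => hne (Subtype.ext e), w.2⟩)

end Basis

theorem closure_interior_simplex {t : Finset (Euc d)}
    (ht : AffineIndependent ℝ ((↑) : t → Euc d)) (hc : t.card = d + 1) :
    closure (interior (convexHull ℝ (t : Set (Euc d)))) = convexHull ℝ (t : Set (Euc d)) := by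
  have hne : (interior (convexHull ℝ (t : Set (Euc d)))).Nonempty := by
    rw [← range_simplexBasis ht hc]
    exact ⟨_, (simplexBasis ht hc).centroid_mem_interior_convexHull⟩
  rw [(convex_convexHull ℝ _).closure_interior_eq_closure_of_nonempty_interior hne]
  exact (t.finite_toSet.isCompact_convexHull ℝ).isClosed.closure_eq

variable {K : Geometry.SimplicialComplex ℝ (Euc d)}

theorem isClosed_simplex (s : Finset (Euc d)) : IsClosed (convexHull ℝ (s : Set (Euc d))) :=
  (s.finite_toSet.isCompact_convexHull ℝ).isClosed

/-- The point lies in the hull of the common vertices of `t` and `u`, where the coordinate of any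
other vertex of `t` is zero. -/
theorem mem_of_coord_pos {t u : Finset (Euc d)} (ht : t ∈ K.faces) (hc : t.card = d + 1)
    (hu : u ∈ K.faces) {x : Euc d} (hxt : x ∈ convexHull ℝ (t : Set (Euc d)))
    (hxu : x ∈ convexHull ℝ (u : Set (Euc d))) {v : t}
    (hv : 0 < (simplexBasis (K.indep ht) hc).coord v x) : v.1 ∈ u := by
  by_contra h
  have := coord_eq_zero_of_mem_convexHull (K.indep ht) hc inter_subset_left
    (fun hm => h (Finset.mem_coe.1 hm.2)) (K.inter_subset_convexHull ht hu ⟨hxt, hxu⟩)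
  exact hv.ne' this

/-- `s` is the smallest simplex of `K` that contains `x`. -/
def IsCarrier (K : Geometry.SimplicialComplex ℝ (Euc d)) (s : Finset (Euc d)) (x : Euc d) :
    Prop :=
  s ∈ K.faces ∧ x ∈ convexHull ℝ (s : Set (Euc d)) ∧
    ∀ u ∈ K.faces, x ∈ convexHull ℝ (u : Set (Euc d)) → s ⊆ u

/-- Take a simplex around `x` with fewest vertices: its intersection with any other simplex around
`x` is again one, so it cannot be smaller. -/
theorem exists_isCarrier {x : Euc d} (hx : x ∈ K.space) : ∃ s, IsCarrier K s x := by
  classical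
  obtain ⟨s₀, hs₀, hx₀⟩ := Geometry.SimplicialComplex.mem_space_iff.1 hx
  obtain ⟨s, ⟨hs, hxs⟩, hmin⟩ := (measure Finset.card).wf.has_min
    {s | s ∈ K.faces ∧ x ∈ convexHull ℝ (s : Set (Euc d))} ⟨s₀, hs₀, hx₀⟩
  refine ⟨s, hs, hxs, fun u hu hxu => ?_⟩
  have hi : x ∈ convexHull ℝ ((s ∩ u : Finset (Euc d)) : Set (Euc d)) := by
    rw [Finset.coe_inter]
    exact K.inter_subset_convexHull hs hu ⟨hxs, hxu⟩
  have hne : (s ∩ u).Nonempty := by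
    rw [← Finset.coe_nonempty]
    exact convexHull_nonempty_iff.1 ⟨x, hi⟩
  have hle := hmin (s ∩ u) ⟨K.down_closed hs Finset.inter_subset_left hne, hi⟩
  have : s ∩ u = s := Finset.eq_of_subset_of_card_le Finset.inter_subset_left (not_lt.1 hle)
  exact Finset.inter_eq_left.1 this

/-- Were the coordinate zero, `x` would lie in the facet of `t` opposite `v`, which would then
contain `s` and so `v`. -/
theorem IsCarrier.coord_pos {s t : Finset (Euc d)} {x : Euc d} (h : IsCarrier K s x)
    (ht : t ∈ K.faces) (hc : t.card = d + 1) (hst : s ⊆ t) {v : t} (hv : v.1 ∈ s) :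
    0 < (simplexBasis (K.indep ht) hc).coord v x := by
  have hxt : x ∈ convexHull ℝ (t : Set (Euc d)) := convexHull_mono (Finset.coe_subset.2 hst) h.2.1
  refine lt_of_le_of_ne ((mem_convexHull_iff_coord _ hc).1 hxt v) fun h0 => ?_
  have hx := mem_convexHull_erase_of_coord_eq_zero (K.indep ht) hc hxt h0.symm
  have hne : (t.erase v.1).Nonempty := by
    rw [← Finset.coe_nonempty]
    exact convexHull_nonempty_iff.1 ⟨x, hx⟩
  have := h.2.2 _ (K.down_closed ht (Finset.erase_subset _ _) hne) hx hv
  simp at this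

theorem isCarrier_of_coord {s t : Finset (Euc d)} {x : Euc d} (hs : s ∈ K.faces)
    (ht : t ∈ K.faces) (hc : t.card = d + 1) (hst : s ⊆ t)
    (hx : x ∈ convexHull ℝ (s : Set (Euc d)))
    (hpos : ∀ v : t, v.1 ∈ s → 0 < (simplexBasis (K.indep ht) hc).coord v x) :
    IsCarrier K s x :=
  ⟨hs, hx, fun _ hu hxu v hv => mem_of_coord_pos ht hc hu
    (convexHull_mono (Finset.coe_subset.2 hst) hx) hxu (hpos ⟨v, hst hv⟩ hv)⟩

/-- Near a point in the relative interior of a facet, a simplex is a half-space. -/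
theorem IsCarrier.eventually_mem_convexHull {s t : Finset (Euc d)} {x : Euc d}
    (h : IsCarrier K s x) (ht : t ∈ K.faces) (hc : t.card = d + 1) (hst : s ⊆ t) (p : t)
    (hp : ∀ v ∈ t, v ≠ p → v ∈ s) :
    ∀ᶠ w in nhds x, 0 ≤ (simplexBasis (K.indep ht) hc).coord p w →
      w ∈ convexHull ℝ (t : Set (Euc d)) := by
  have hev : ∀ᶠ w in nhds x, ∀ v : t, v ≠ p → 0 < (simplexBasis (K.indep ht) hc).coord v w := by
    rw [Filter.eventually_all]
    intro v
    by_cases hv : v = p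
    · simp [hv]
    · have := h.coord_pos ht hc hst (hp v v.2 fun e => hv (Subtype.ext e))
      filter_upwards [(continuous_coord_simplexBasis (K.indep ht) hc v).continuousAt.eventually
        (lt_mem_nhds this)] with w hw _ using hw
  filter_upwards [hev] with w hw hpw
  rw [mem_convexHull_iff_coord (K.indep ht) hc]
  intro v
  by_cases hv : v = p
  · rwa [hv]
  · exact (hw v hv).le

/-- The finitely many closed simplices that miss `x` also miss a neighbourhood of `x`. -/
theorem eventually_forall_mem_convexHull (hK : K.faces.Finite) (x : Euc d) :
    ∀ᶠ w in nhds x, ∀ u ∈ K.faces, w ∈ convexHull ℝ (u : Set (Euc d)) →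
      x ∈ convexHull ℝ (u : Set (Euc d)) := by
  rw [hK.eventually_all]
  intro u _
  by_cases hx : x ∈ convexHull ℝ (u : Set (Euc d))
  · simp [hx]
  · filter_upwards [(isClosed_simplex u).isOpen_compl.mem_nhds hx] with w hw hwu
    exact absurd hwu hw

theorem card_le_of_mem_faces {s : Finset (Euc d)} (hs : s ∈ K.faces) : s.card ≤ d + 1 := by
  have h := (K.indep hs).card_le_finrank_succ
  have h2 := Submodule.finrank_le (vectorSpan ℝ (range ((↑) : s → Euc d)))
  simp only [Fintype.card_coe, finrank_euclideanSpace, Fintype.card_fin] at h h2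
  omega

/-- Simplices of lower dimension are null while `W` is not, and a point of a `d`-simplex is a limit
of interior points. -/
theorem exists_simplex_inter_nonempty (hK : K.faces.Finite) {W : Set (Euc d)} (hW : IsOpen W)
    (hne : W.Nonempty) (hsub : W ⊆ K.space) :
    ∃ u ∈ K.faces, u.card = d + 1 ∧
      (W ∩ interior (convexHull ℝ (u : Set (Euc d)))).Nonempty := by
  by_contra! hcon
  have hnull : volume W = 0 := by
    refine measure_mono_null (t := ⋃ u ∈ {u ∈ K.faces | u.card ≠ d + 1},
      convexHull ℝ (u : Set (Euc d))) (fun w hw => ?_) ?_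
    · obtain ⟨u, hu, hwu⟩ := Geometry.SimplicialComplex.mem_space_iff.1 (hsub hw)
      refine mem_biUnion (x := u) ⟨hu, fun hc => ?_⟩ hwu
      rw [← closure_interior_simplex (K.indep hu) hc] at hwu
      obtain ⟨z, hz⟩ := mem_closure_iff.1 hwu W hW hw
      exact (hcon u hu hc ▸ hz : z ∈ (∅ : Set (Euc d)))
    · refine (measure_biUnion_null_iff (hK.subset (sep_subset _ _)).countable).2 fun u hu => ?_
      refine measure_mono_null (convexHull_subset_affineSpan _)
        (Measure.addHaar_affineSubspace volume _ fun htop => hu.2 ?_)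
      have := (K.indep hu.1).affineSpan_eq_top_iff_card_eq_finrank_add_one.1
        (by rw [Subtype.range_coe]; exact htop)
      simpa using this
  exact (hW.measure_pos volume hne).ne' hnull

/-- A simplex with at most `d - 1` vertices is null for the surface measure. -/
theorem hausdorffMeasure_convexHull_eq_zero {s : Finset (Euc d)} (hne : s.Nonempty)
    (hs : s.card < d) :
    (μHE[d - 1] : Measure (Euc d)) (convexHull ℝ (s : Set (Euc d))) = 0 := by
  obtain ⟨p, hp⟩ := hne
  -- The affine dimension is at most `s.card - 1`; `s` is nonempty, so no subtraction is truncated.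
  have hrank : Module.finrank ℝ (vectorSpan ℝ (s : Set (Euc d))) < d - 1 := by
    have h := finrank_vectorSpan_image_finset_le ℝ (id : Euc d → Euc d) s (n := s.card - 1)
      (by have := Finset.card_pos.2 ⟨p, hp⟩; omega)
    rw [Finset.image_id] at h
    have := Finset.card_pos.2 ⟨p, hp⟩
    omega
  have hsub : convexHull ℝ (s : Set (Euc d)) ⊆
      (fun z : vectorSpan ℝ (s : Set (Euc d)) => (z : Euc d) + p) '' univ := by
    intro x hx
    have hx' := convexHull_subset_affineSpan (s : Set (Euc d)) hx
    have hp' := subset_affineSpan ℝ (s : Set (Euc d)) hp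
    refine ⟨⟨x - p, ?_⟩, trivial, by simp⟩
    rw [← direction_affineSpan]
    exact AffineSubspace.vsub_mem_direction hx' hp'
  have hlip : LipschitzWith 1 (fun z : vectorSpan ℝ (s : Set (Euc d)) => (z : Euc d) + p) := by
    refine LipschitzWith.of_dist_le_mul fun z w => ?_
    simp [Subtype.dist_eq]
  have hdim : dimH (convexHull ℝ (s : Set (Euc d))) < ((d - 1 : ℕ) : NNReal) := by
    refine ((dimH_mono hsub).trans (hlip.dimH_image_le univ)).trans_lt ?_
    rw [Real.dimH_univ_eq_finrank]
    exact_mod_cast hrank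
  have h0 := hausdorffMeasure_of_dimH_lt hdim
  rw [Measure.euclideanHausdorffMeasure_def, Measure.smul_apply]
  simp only [NNReal.coe_natCast] at h0
  rw [h0, smul_zero]

end Complex

/-! ### Number of faces of a cell -/

section Count

variable {d : ℕ} {Ω : Set (Euc d)} {M : Mesh Ω} {K : Geometry.SimplicialComplex ℝ (Euc d)}
  {T : Set (Euc d)}

theorem Mesh.IsMatchingSubmesh.interior_subset_cell (h : M.IsMatchingSubmesh K)
    {u : Finset (Euc d)} (hu : u ∈ K.faces) (hc : u.card = d + 1) (hT : T ∈ M.cells)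
    (hne : (T ∩ interior (convexHull ℝ (u : Set (Euc d)))).Nonempty) :
    interior (convexHull ℝ (u : Set (Euc d))) ⊆ T := by
  obtain ⟨T', hT', hsub⟩ := h.simplex_subset u hu hc
  obtain ⟨z, hzT, hz⟩ := hne
  have : T = T' := by
    by_contra hneq
    exact Set.disjoint_left.1 (M.cell_disjoint T hT T' hT' hneq) hzT (hsub hz)
  rwa [this]

/-- Close enough to `x`, every simplex that is met contains `x`. The open set `W` may be smaller
than `T`, so that the simplex can be sought on a prescribed side of a hyperplane. -/
theorem Mesh.IsMatchingSubmesh.exists_simplex_of_mem_closure (h : M.IsMatchingSubmesh K)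
    (hT : T ∈ M.cells) {W : Set (Euc d)} (hW : IsOpen W) (hWT : W ⊆ T) {x : Euc d}
    (hx : x ∈ closure W) :
    ∃ t ∈ K.faces, t.card = d + 1 ∧ interior (convexHull ℝ (t : Set (Euc d))) ⊆ T ∧
      x ∈ convexHull ℝ (t : Set (Euc d)) ∧
      (W ∩ interior (convexHull ℝ (t : Set (Euc d)))).Nonempty := by
  obtain ⟨N, hN, hNo, hxN⟩ := eventually_nhds_iff.1 (eventually_forall_mem_convexHull h.finite x)
  have hne : (W ∩ N).Nonempty := by
    rw [inter_comm]; exact mem_closure_iff.1 hx N hNo hxN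
  have hsub : W ∩ N ⊆ K.space := by
    rw [h.space_eq]
    exact fun z hz => subset_closure (M.cell_subset T hT (hWT hz.1))
  obtain ⟨u, hu, hc, z, ⟨hzW, hzN⟩, hz⟩ :=
    exists_simplex_inter_nonempty h.finite (hW.inter hNo) hne hsub
  exact ⟨u, hu, hc, h.interior_subset_cell hu hc hT ⟨z, hWT hzW, hz⟩,
    hN z hzN u hu (interior_subset hz), z, hzW, hz⟩

theorem exists_vertex_notMem {s t : Finset (Euc d)} (hst : s ⊆ t) (hs : s.card = d)
    (hc : t.card = d + 1) :
    ∃ p : t, p.1 ∉ s ∧ (∀ v ∈ t, v ≠ p.1 → v ∈ s) ∧ t.erase p.1 = s := by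
  obtain ⟨p, hp⟩ : (t \ s).Nonempty := by
    rw [← Finset.card_pos, Finset.card_sdiff_of_subset hst]; omega
  rw [Finset.mem_sdiff] at hp
  have he : t.erase p = s := by
    refine (Finset.eq_of_subset_of_card_le (fun v hv => ?_) ?_).symm
    · exact Finset.mem_erase.2 ⟨fun e => hp.2 (e ▸ hv), hst hv⟩
    · rw [Finset.card_erase_of_mem hp.1]; omega
  exact ⟨⟨p, hp.1⟩, hp.2, fun v hv hne => he ▸ Finset.mem_erase.2 ⟨hne, hv⟩, he⟩

/-- A cell that meets the relative interior of a `(d-1)`-simplex contains it. -/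
theorem Mesh.IsMatchingSubmesh.mem_cell_of_isCarrier (h : M.IsMatchingSubmesh K)
    (hT : T ∈ M.cells) {s t : Finset (Euc d)} (hs : s.card = d) (ht : t ∈ K.faces)
    (hc : t.card = d + 1) (hst : s ⊆ t)
    (htT : interior (convexHull ℝ (t : Set (Euc d))) ⊆ T) {x y : Euc d}
    (hx : IsCarrier K s x) (hy : IsCarrier K s y) (hyT : y ∈ T) : x ∈ T := by
  have hTp := M.cell_polyhedron T hT
  obtain ⟨p, hps, hp, -⟩ := exists_vertex_notMem hst hs hc
  -- `f` vanishes on the hyperplane of `s` and is positive on the side of `t`.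
  set f : Euc d →ᵃ[ℝ] ℝ := (simplexBasis (K.indep ht) hc).coord p with hf
  have hfc : Continuous f := continuous_coord_simplexBasis _ hc p
  have hfs : ∀ v ∈ s, f v = 0 := fun v hv =>
    coord_simplexBasis_of_ne _ hc (hst hv) fun e => hps (e ▸ hv)
  have hfy : f y = 0 := affineMap_eq_zero_of_mem_convexHull hfs hy.2.1
  have hfp : f p = 1 := coord_simplexBasis_self _ hc p
  -- `T` is a neighbourhood of `y`, so moving from `y` slightly away from `p` stays in `T` and
  -- reaches the other side.
  have hcl : y ∈ closure (T ∩ {z | f z < 0}) := by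
    have hcont : Continuous fun ε : ℝ => AffineMap.lineMap y (p : Euc d) ε :=
      AffineMap.lineMap_continuous
    have ht0 : Filter.Tendsto (fun ε : ℝ => AffineMap.lineMap y (p : Euc d) ε)
        (nhdsWithin 0 (Iio 0)) (nhds y) := by
      have := hcont.tendsto 0
      rw [AffineMap.lineMap_apply_zero] at this
      exact this.mono_left nhdsWithin_le_nhds
    refine mem_closure_of_tendsto ht0 ?_
    filter_upwards [ht0.eventually (hTp.isOpen.mem_nhds hyT), self_mem_nhdsWithin] with ε h1 h2
    refine ⟨h1, ?_⟩
    rw [mem_ofPred_eq, AffineMap.apply_lineMap, hfy, hfp, AffineMap.lineMap_apply]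
    simpa using h2
  -- A second simplex of `T` at `y`, with an interior point on the negative side; it contains `s`
  -- because `s` carries `y`.
  obtain ⟨u, hu, huc, huT, hyu, w, ⟨-, hfw⟩, hwu⟩ := h.exists_simplex_of_mem_closure hT
    (hTp.isOpen.inter (isOpen_lt hfc continuous_const)) inter_subset_left hcl
  have hsu : s ⊆ u := hy.2.2 u hu hyu
  obtain ⟨q, hqs, hq, -⟩ := exists_vertex_notMem hsu hs huc
  have hfq := eq_coord_mul (K.indep hu) huc (f := f) (p := q) fun v hv hne => hfs v (hq v hv hne)
  have hq0 : f q < 0 := by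
    have h1 := (mem_interior_convexHull_iff_coord (K.indep hu) huc).1 hwu q
    have h2 := hfq w
    have h3 : f w < 0 := hfw
    by_contra hcon
    rw [not_lt] at hcon
    exact absurd (mul_nonneg h1.le hcon) (by rw [← h2]; exact not_le.2 h3)
  have hclt : convexHull ℝ (t : Set (Euc d)) ⊆ closure T := by
    rw [← closure_interior_simplex (K.indep ht) hc]; exact closure_mono htT
  have hclu : convexHull ℝ (u : Set (Euc d)) ⊆ closure T := by
    rw [← closure_interior_simplex (K.indep hu) huc]; exact closure_mono huT
  -- Near `x`, `t` fills the side `f ≥ 0` and `u` the side `f < 0`, so the closure of `T` is a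
  -- neighbourhood of `x`.
  rw [← hTp.interior_closure, mem_interior_iff_mem_nhds]
  filter_upwards [hx.eventually_mem_convexHull ht hc hst p hp,
    hx.eventually_mem_convexHull hu huc hsu q hq] with z hz1 hz2
  rcases le_or_gt 0 (f z) with h0 | h0
  · exact hclt (hz1 h0)
  · refine hclu (hz2 ?_)
    by_contra hcon
    rw [not_le] at hcon
    have := mul_pos_of_neg_of_neg hcon hq0
    rw [← hfq z] at this
    exact absurd this (not_lt.2 h0.le)

/-- Every face of a cell `T` contains a facet of a simplex in `T`, and a point of this facet lies
in no other face. -/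
theorem Mesh.IsMatchingSubmesh.exists_facet_subset (h : M.IsMatchingSubmesh K)
    (hT : T ∈ M.cells) {F : Set (Euc d)} (hF : F ∈ M.facesOf T) :
    ∃ t ∈ K.faces, t.card = d + 1 ∧ interior (convexHull ℝ (t : Set (Euc d))) ⊆ T ∧
      ∃ v ∈ t, convexHull ℝ ((t.erase v : Finset (Euc d)) : Set (Euc d)) ⊆ F ∧
        ∃ x ∈ convexHull ℝ ((t.erase v : Finset (Euc d)) : Set (Euc d)),
          ∀ F' ∈ M.faces, x ∈ F' → F' = F := by
  have hFM := M.mem_faces_of_mem_facesOf hF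
  have hTp := M.cell_polyhedron T hT
  -- A generic point of `F`: overlaps with other faces and simplices with fewer than `d` vertices
  -- are null, while `F` has positive measure.
  obtain ⟨x, hxF, hxF', hxs⟩ : ∃ x ∈ F, (∀ F' ∈ M.faces, x ∈ F' → F' = F) ∧
      ∀ s ∈ K.faces, x ∈ convexHull ℝ (s : Set (Euc d)) → d ≤ s.card := by
    by_contra! hcon
    have hsub : F ⊆ (⋃ F' ∈ {F' ∈ (M.faces : Set (Set (Euc d))) | F' ≠ F}, F ∩ F') ∪
        ⋃ s ∈ {s ∈ K.faces | s.card < d}, convexHull ℝ (s : Set (Euc d)) := by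
      intro x hx
      by_cases hx' : ∀ F' ∈ M.faces, x ∈ F' → F' = F
      · obtain ⟨s, hs, hxs, hc⟩ := hcon x hx hx'
        exact Or.inr (mem_biUnion (x := s) ⟨hs, hc⟩ hxs)
      · push Not at hx'
        obtain ⟨F', hF', hxF', hne⟩ := hx'
        exact Or.inl (mem_biUnion (x := F') ⟨hF', hne⟩ ⟨hx, hxF'⟩)
    refine (M.face_measure_pos F hFM).ne' (measure_mono_null hsub (measure_union_null ?_ ?_))
    · refine (measure_biUnion_null_iff
        (M.faces.finite_toSet.subset (sep_subset _ _)).countable).2 fun F' hF' => ?_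
      exact M.face_overlap F hFM F' hF'.1 hF'.2.symm
    · refine (measure_biUnion_null_iff (h.finite.subset (sep_subset _ _)).countable).2
        fun s hs => ?_
      exact hausdorffMeasure_convexHull_eq_zero
        (Geometry.SimplicialComplex.nonempty_of_mem_faces hs.1) hs.2
  have hxT : x ∈ frontier T := M.subset_frontier_of_mem_facesOf hF hxF
  have hxcl : x ∈ closure T := frontier_subset_closure hxT
  have hxnot : x ∉ T := by
    rw [hTp.isOpen.frontier_eq] at hxT; exact hxT.2
  have hxK : x ∈ K.space := by
    rw [h.space_eq]; exact closure_mono (M.cell_subset T hT) hxcl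
  obtain ⟨s, hs⟩ := exists_isCarrier hxK
  obtain ⟨t, ht, hc, htT, hxt, -⟩ := h.exists_simplex_of_mem_closure hT hTp.isOpen subset_rfl hxcl
  have hst : s ⊆ t := hs.2.2 t ht hxt
  -- With `d + 1` vertices, the carrier would be a simplex of `T` with `x` in its interior, hence `x
  -- ∈ T`.
  have hsd : s.card = d := by
    refine le_antisymm (Nat.lt_succ_iff.1 (lt_of_le_of_ne (card_le_of_mem_faces hs.1) fun e => ?_))
      (hxs s hs.1 hs.2.1)
    have hstE : s = t := Finset.eq_of_subset_of_card_le hst (by rw [e, hc])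
    subst hstE
    exact hxnot (htT ((mem_interior_convexHull_iff_coord (K.indep ht) hc).2 fun v =>
      hs.coord_pos ht hc subset_rfl v.2))
  -- A point `y` of the facet off the skeleton would lie in `T`. Moving slightly towards `x` gives a
  -- point of `T` whose carrier is `s`, and then `x` itself would lie in `T`.
  have hskel : convexHull ℝ (s : Set (Euc d)) ⊆ ⋃ T ∈ M.cells, frontier T := by
    intro y hy
    by_contra hcon
    have hyT : y ∈ T := by
      by_contra hyn
      refine hcon (mem_biUnion (x := T) hT ?_)
      rw [hTp.isOpen.frontier_eq]
      refine ⟨closure_mono htT ?_, hyn⟩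
      rw [closure_interior_simplex (K.indep ht) hc]
      exact convexHull_mono (Finset.coe_subset.2 hst) hy
    obtain ⟨ε, hε0, hε1, hεT⟩ : ∃ ε : ℝ, 0 < ε ∧ ε ≤ 1 ∧ AffineMap.lineMap y x ε ∈ T := by
      have hcont : Continuous fun ε : ℝ => AffineMap.lineMap y x ε := AffineMap.lineMap_continuous
      have ht0 : Filter.Tendsto (fun ε : ℝ => AffineMap.lineMap y x ε)
          (nhdsWithin 0 (Ioi 0)) (nhds y) := by
        have := hcont.tendsto 0
        rw [AffineMap.lineMap_apply_zero] at this
        exact this.mono_left nhdsWithin_le_nhds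
      obtain ⟨ε, h1, h2⟩ := ((ht0.eventually (hTp.isOpen.mem_nhds hyT)).and
        (Ioc_mem_nhdsGT (zero_lt_one' ℝ))).exists
      exact ⟨ε, h2.1, h2.2, h1⟩
    refine hxnot (h.mem_cell_of_isCarrier hT hsd ht hc hst htT hs
      (isCarrier_of_coord hs.1 ht hc hst ?_ fun v hv => ?_) hεT)
    · exact (convex_convexHull ℝ _).segment_subset hy hs.2.1
        (segment_eq_image_lineMap ℝ y x ▸ mem_image_of_mem _ ⟨hε0.le, hε1⟩)
    · have h1 := hs.coord_pos ht hc hst hv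
      have h2 := (mem_convexHull_iff_coord (K.indep ht) hc).1
        (convexHull_mono (Finset.coe_subset.2 hst) hy) v
      rw [AffineMap.apply_lineMap, AffineMap.lineMap_apply_module, smul_eq_mul, smul_eq_mul]
      have := mul_nonneg (sub_nonneg.2 hε1) h2
      have := mul_pos hε0 h1
      linarith
  obtain ⟨F', hF', hsF'⟩ := h.subface_subset s hs.1 hsd hskel
  have hFF : F' = F := hxF' F' hF' (hsF' hs.2.1)
  obtain ⟨p, -, -, hp⟩ := exists_vertex_notMem hst hsd hc
  exact ⟨t, ht, hc, htT, p, p.2, by rw [hp, ← hFF]; exact hsF', x, by rw [hp]; exact hs.2.1, hxF'⟩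

/-- The simplices of `K` in the cell `T`. -/
def cellSimplices (K : Geometry.SimplicialComplex ℝ (Euc d)) (T : Set (Euc d)) :
    Set (Finset (Euc d)) :=
  {t | t ∈ K.faces ∧ t.card = d + 1 ∧ interior (convexHull ℝ (t : Set (Euc d))) ⊆ T}

/-- Each face is sent to a pair of a simplex and the vertex opposite the chosen facet. The point
that lies on no other face makes this injective, and each simplex offers `d + 1` vertices. -/
theorem Mesh.IsMatchingSubmesh.card_facesOf_le (h : M.IsMatchingSubmesh K) (hT : T ∈ M.cells) :
    (M.facesOf T).card ≤ (d + 1) * (cellSimplices K T).ncard := by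
  classical
  have hfin : (cellSimplices K T).Finite := h.finite.subset fun t ht => ht.1
  have hex : ∀ F : M.facesOf T, ∃ t v, t ∈ cellSimplices K T ∧ v ∈ t ∧
      convexHull ℝ ((t.erase v : Finset (Euc d)) : Set (Euc d)) ⊆ F.1 ∧
        ∃ x ∈ convexHull ℝ ((t.erase v : Finset (Euc d)) : Set (Euc d)),
          ∀ F' ∈ M.faces, x ∈ F' → F' = F.1 := by
    intro F
    obtain ⟨t, h1, h2, h3, v, h4, h5⟩ := h.exists_facet_subset hT F.2
    exact ⟨t, v, ⟨h1, h2, h3⟩, h4, h5⟩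
  choose t v ht hv hsub x hx hxF using hex
  let P : Finset (Σ _ : Finset (Euc d), Euc d) := hfin.toFinset.sigma fun t => t
  have hle : (Finset.univ : Finset (M.facesOf T)).card ≤ P.card := by
    refine Finset.card_le_card_of_injOn (fun F => ⟨t F, v F⟩) (fun F _ => ?_) fun F _ F' _ e => ?_
    · exact Finset.mem_coe.2 (Finset.mem_sigma.2 ⟨hfin.mem_toFinset.2 (ht F), hv F⟩)
    · simp only [Sigma.mk.injEq, heq_eq_eq] at e
      have h1 := hx F
      rw [e.1, e.2] at h1
      exact (Subtype.ext (hxF F F'.1 (M.mem_faces_of_mem_facesOf F'.2) (hsub F' h1))).symm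
  have hP : P.card = (d + 1) * (cellSimplices K T).ncard := by
    rw [Finset.card_sigma, Finset.sum_congr rfl fun t ht => (hfin.mem_toFinset.1 ht).2.1,
      Finset.sum_const, smul_eq_mul, mul_comm, Set.ncard_eq_toFinset_card _ hfin]
  rw [hP] at hle
  simpa using hle

theorem disjoint_interior_simplices {t u : Finset (Euc d)} (ht : t ∈ K.faces)
    (hc : t.card = d + 1) (hu : u ∈ K.faces) (huc : u.card = d + 1) (hne : t ≠ u) :
    Disjoint (interior (convexHull ℝ (t : Set (Euc d))))
      (interior (convexHull ℝ (u : Set (Euc d)))) := by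
  rw [Set.disjoint_left]
  intro x hxt hxu
  refine hne (Finset.eq_of_subset_of_card_le (fun v hv => ?_) (by rw [hc, huc]))
  exact mem_of_coord_pos ht hc hu (interior_subset hxt) (interior_subset hxu)
    ((mem_interior_convexHull_iff_coord (K.indep ht) hc).1 hxt ⟨v, hv⟩)

/-- Volume comparison: the simplices contain pairwise disjoint balls of radius `r`, all inside one
ball of radius `diam T`. -/
theorem ncard_cellSimplices_le (hK : K.faces.Finite) (hT : Bornology.IsBounded T)
    (hne : T.Nonempty) {r : ℝ} (hr : 0 < r)
    (hball : ∀ t ∈ cellSimplices K T, ∃ c, Metric.ball c r ⊆ convexHull ℝ (t : Set (Euc d))) :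
    ((cellSimplices K T).ncard : ℝ) * r ^ d ≤ Metric.diam T ^ d := by
  have hfin : (cellSimplices K T).Finite := hK.subset fun t ht => ht.1
  obtain ⟨c₀, hc₀⟩ := hne
  have : Nonempty (Euc d) := ⟨c₀⟩
  choose! c hc using hball
  have hsub : ∀ t ∈ cellSimplices K T,
      Metric.ball (c t) r ⊆ interior (convexHull ℝ (t : Set (Euc d))) :=
    fun t ht => interior_maximal (hc t ht) Metric.isOpen_ball
  have hvol : volume (⋃ t ∈ hfin.toFinset, Metric.ball (c t) r) =
      ∑ t ∈ hfin.toFinset, volume (Metric.ball (c t) r) := by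
    refine measure_biUnion_finset (fun t ht u hu htu => ?_) fun t _ => measurableSet_ball
    rw [Finset.mem_coe, hfin.mem_toFinset] at ht hu
    exact (disjoint_interior_simplices ht.1 ht.2.1 hu.1 hu.2.1 htu).mono (hsub t ht) (hsub u hu)
  have hle : volume (⋃ t ∈ hfin.toFinset, Metric.ball (c t) r) ≤
      volume (Metric.closedBall c₀ (Metric.diam T)) := by
    refine measure_mono (iUnion₂_subset fun t ht => ?_)
    have ht' := hfin.mem_toFinset.1 ht
    exact (hsub t ht').trans (ht'.2.2.trans fun y hy => Metric.dist_le_diam_of_mem hT hy hc₀)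
  rw [hvol, Measure.addHaar_closedBall _ _ Metric.diam_nonneg] at hle
  simp only [Measure.addHaar_ball_of_pos _ _ hr, Finset.sum_const, finrank_euclideanSpace,
    Fintype.card_fin, nsmul_eq_mul] at hle
  rw [← mul_assoc] at hle
  have hb0 : volume (Metric.ball (0 : Euc d) 1) ≠ 0 := (Metric.measure_ball_pos _ _ one_pos).ne'
  have hbt : volume (Metric.ball (0 : Euc d) 1) ≠ ⊤ := Metric.isBounded_ball.measure_lt_top.ne
  have hle2 := (ENNReal.mul_le_mul_iff_left hb0 hbt).1 hle
  rw [← ENNReal.ofReal_natCast, ← ENNReal.ofReal_mul (by positivity),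
    ENNReal.ofReal_le_ofReal_iff (pow_nonneg Metric.diam_nonneg _)] at hle2
  rwa [Set.ncard_eq_toFinset_card _ hfin]

end Count

/-! ### Local estimates -/

section Local

variable {d k : ℕ} {Ω : Set (Euc d)}

theorem integrableOn_norm_sq {E : Type*} [NormedAddCommGroup E] {f : Euc d → E}
    (hf : Continuous f) {T : Set (Euc d)} (hT : Bornology.IsBounded T) :
    IntegrableOn (fun x => ‖f x‖ ^ 2) T :=
  (memLp_two_of_continuous hf hT).integrable_norm_pow (by norm_num)

/-- `∇R_T` is the projection of `G_T` onto gradients. -/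
theorem Mesh.integral_norm_gradR_sq_le (M : Mesh Ω) (hd : 1 ≤ d) {T : Set (Euc d)}
    (hT : T ∈ M.cells) (v : M.LocalDof k T) :
    ∫ x in T, ‖M.gradR T v x‖ ^ 2 ≤ ∫ x in T, ‖M.G T v x‖ ^ 2 := by
  have hb := (M.cell_polyhedron T hT).isBounded
  have h1 := M.potRecon_spec hd hT v (M.potRecon T v)
  have h2 := M.gradRecon_spec hd hT v
    (fun i => ⟨grad (M.potRecon T v).1 i, grad_mem_poly _ i⟩)
  -- Tested with `∇R`, both reconstructions have the same right-hand side.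
  have h3 : ∫ x in T, ‖M.gradR T v x‖ ^ 2 = ∫ x in T, inner ℝ (M.G T v x) (M.gradR T v x) := by
    simp only [← real_inner_self_eq_norm_sq]
    exact h1.trans h2.symm
  have h4 := sq_integral_inner_le (memLp_two_of_continuous (continuous_evVec _) hb :
    MemLp (M.G T v) 2 (volume.restrict T)) (memLp_two_of_continuous (continuous_evVec _) hb :
    MemLp (M.gradR T v) 2 (volume.restrict T))
  change (∫ x in T, inner ℝ (M.G T v x) (M.gradR T v x)) ^ 2 ≤
    (∫ x in T, ‖M.G T v x‖ ^ 2) * ∫ x in T, ‖M.gradR T v x‖ ^ 2 at h4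
  rw [← h3] at h4
  set X := ∫ x in T, ‖M.gradR T v x‖ ^ 2
  have hX : 0 ≤ X := integral_nonneg fun _ => sq_nonneg _
  have hY : 0 ≤ ∫ x in T, ‖M.G T v x‖ ^ 2 := integral_nonneg fun _ => sq_nonneg _
  rcases hX.eq_or_lt with h0 | h0
  · rwa [← h0]
  · rw [sq] at h4
    exact le_of_mul_le_mul_right h4 h0

theorem norm_evVec_sq (τ : Fin d → MvPolynomial (Fin d) ℝ) (x : Euc d) :
    ‖evVec τ x‖ ^ 2 = ∑ i, ev (τ i) x ^ 2 := by
  simp [EuclideanSpace.norm_sq_eq]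

theorem integral_ball_sq_le {T : Set (Euc d)} (hb : Bornology.IsBounded T) {c : Euc d} {r : ℝ}
    (hball : Metric.ball c r ⊆ T) {E : Type*} [NormedAddCommGroup E] {f : Euc d → E}
    (hf : Continuous f) :
    ∫ y in Metric.ball c r, ‖f y‖ ^ 2 ≤ ∫ y in T, ‖f y‖ ^ 2 :=
  setIntegral_mono_set (integrableOn_norm_sq hf hb)
    (Filter.Eventually.of_forall fun _ => sq_nonneg _) (LE.le.eventuallyLE hball)

/-- On the closure of a cell that contains a ball of comparable diameter, a polynomial differs from
its projection onto polynomials of one degree less by at most its gradient. -/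
theorem exists_sq_sub_cellProj_le (d k : ℕ) {r : ℝ} (hr : 0 < r) :
    ∃ C : ℝ, 0 ≤ C ∧ ∀ (Ω : Set (Euc d)) (M : Mesh Ω), ∀ T ∈ M.cells, ∀ (c : Euc d) (h : ℝ),
      0 < h → Metric.ball c (r * h) ⊆ T → T ⊆ Metric.closedBall c h →
      ∀ p : Poly d (k + 1), ∀ x ∈ closure T,
        (ev p.1 x - ev (cellProj k T (ev p.1)).1 x) ^ 2 ≤
          C * (h ^ 2 * (h ^ d)⁻¹) * ∫ y in T, ‖evVec (grad p.1) y‖ ^ 2 := by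
  obtain ⟨C₀, hC₀, H⟩ := exists_sup_le_l2 d k hr
  set ω := (volume : Measure (Euc d)).real (Metric.closedBall 0 1) with hω
  have hω0 : 0 ≤ ω := measureReal_nonneg
  -- From `(A - B)² ≤ 2 A² + 2 B²`, where `A = p x - p c` has `A² ≤ D2 h²` and `B = q x` has `B² ≤
  -- C₀ ω D2 h²`.
  refine ⟨2 * (1 + C₀ * ω) * C₀, by positivity, fun Ω M T hT c h hh hball hcl p x hx => ?_⟩
  have hb := (M.cell_polyhedron T hT).isBounded
  have := isFiniteMeasure_restrict hb
  set I := ∫ y in T, ‖evVec (grad p.1) y‖ ^ 2 with hI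
  have hI0 : 0 ≤ I := integral_nonneg fun _ => sq_nonneg _
  set D2 := C₀ * (h ^ d)⁻¹ * I with hD2
  have hD20 : 0 ≤ D2 := by positivity
  -- The bound holds on the whole ball, which is convex, so the mean value inequality applies
  -- although `T` need not be convex.
  have hgrad : ∀ y ∈ Metric.closedBall c h, ‖evVec (grad p.1) y‖ ≤ √D2 := by
    intro y hy
    refine Real.le_sqrt_of_sq_le ?_
    rw [norm_evVec_sq]
    refine (Finset.sum_le_sum fun i _ => H c h hh ⟨_, grad_mem_poly p i⟩ y hy).trans ?_
    rw [← Finset.mul_sum, ← integral_finsetSum]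
    · simp only [← norm_evVec_sq]
      exact mul_le_mul_of_nonneg_left (integral_ball_sq_le hb hball (continuous_evVec _))
        (by positivity)
    · intro i _
      have hi := integrableOn_norm_sq (continuous_ev (grad p.1 i))
        (Metric.isBounded_ball (x := c) (r := r * h))
      simp only [Real.norm_eq_abs, sq_abs] at hi
      exact hi
  have hosc : ∀ y ∈ Metric.closedBall c h, (ev p.1 y - ev p.1 c) ^ 2 ≤ D2 * h ^ 2 := by
    intro y hy
    have h1 := abs_ev_sub_le p.1 hgrad hy
    calc (ev p.1 y - ev p.1 c) ^ 2 = |ev p.1 y - ev p.1 c| ^ 2 := (sq_abs _).symm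
      _ ≤ (√D2 * h) ^ 2 := pow_le_pow_left₀ (abs_nonneg _) h1 2
      _ = D2 * h ^ 2 := by rw [mul_pow, Real.sq_sqrt hD20]
  have hCmem : MvPolynomial.C (ev p.1 c) ∈ Poly d k :=
    (MvPolynomial.mem_restrictTotalDegree _ _ _).2 (by simp)
  -- Constants are fixed by the projection, so `q` is the projection of `p - p c` and has no larger
  -- `L²` norm.
  set q : Poly d k := cellProj k T (ev p.1) - ⟨_, hCmem⟩ with hq
  have hqev : ∀ y, ev q.1 y = ev (cellProj k T (ev p.1)).1 y - ev p.1 c := fun y => by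
    rw [hq, Submodule.coe_sub, ev_sub, ev_C]
  have hmq := memLp_two_of_continuous (continuous_ev q.1) hb
  have hmp := memLp_two_of_continuous (f := fun y => ev p.1 y - ev p.1 c)
    ((continuous_ev p.1).sub continuous_const) hb
  have hmul : ∀ {f g : Euc d → ℝ}, Continuous f → Continuous g →
      Integrable (fun y => f y * g y) (volume.restrict T) := fun hf hg =>
    (memLp_two_of_continuous hf hb).integrable_mul (memLp_two_of_continuous hg hb)
  have hqq : ∫ y in T, ‖ev q.1 y‖ ^ 2 = ∫ y in T, inner ℝ (ev p.1 y - ev p.1 c) (ev q.1 y) := by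
    have h1 := M.cellProj_spec k hT (continuous_ev p.1) q
    have e1 : ∀ y, ‖ev q.1 y‖ ^ 2 =
        ev (cellProj k T (ev p.1)).1 y * ev q.1 y - ev p.1 c * ev q.1 y := fun y => by
      rw [Real.norm_eq_abs, sq_abs, sq]
      nth_rewrite 1 [hqev y]
      ring
    have e2 : ∀ y, inner ℝ (ev p.1 y - ev p.1 c) (ev q.1 y) =
        ev p.1 y * ev q.1 y - ev p.1 c * ev q.1 y := fun y => by
      simp only [RCLike.inner_apply, conj_trivial]; ring
    simp only [e1, e2]
    rw [integral_sub (hmul (continuous_ev _) (continuous_ev _))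
      (hmul continuous_const (continuous_ev _)), integral_sub
      (hmul (continuous_ev _) (continuous_ev _)) (hmul continuous_const (continuous_ev _)), h1]
  have hpint : ∫ y in T, ‖ev p.1 y - ev p.1 c‖ ^ 2 ≤ D2 * h ^ 2 * (h ^ d * ω) := by
    have hvol : volume.real T ≤ h ^ d * ω := by
      have h1 := measureReal_mono (μ := volume) hcl
        (isCompact_closedBall c h).measure_lt_top.ne
      refine h1.trans_eq ?_
      rw [hω, measureReal_def, Measure.addHaar_closedBall' _ _ hh.le, ENNReal.toReal_mul,
        ENNReal.toReal_ofReal (by positivity), finrank_euclideanSpace, Fintype.card_fin,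
        measureReal_def]
    have h2 : ∫ y in T, ‖ev p.1 y - ev p.1 c‖ ^ 2 ≤ ∫ _ in T, D2 * h ^ 2 := by
      refine setIntegral_mono_on (integrableOn_norm_sq
        ((continuous_ev p.1).sub continuous_const) hb) (integrable_const _)
        (M.cell_polyhedron T hT).isOpen.measurableSet fun y hy => ?_
      rw [Real.norm_eq_abs, sq_abs]
      exact hosc y (hcl hy)
    refine h2.trans ?_
    rw [setIntegral_const, smul_eq_mul, mul_comm]
    exact mul_le_mul_of_nonneg_left hvol (by positivity)
  have hqint : ∫ y in T, ‖ev q.1 y‖ ^ 2 ≤ D2 * h ^ 2 * (h ^ d * ω) := by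
    refine le_trans ?_ hpint
    have h1 := sq_integral_inner_le hmp hmq
    rw [← hqq] at h1
    set X := ∫ y in T, ‖ev q.1 y‖ ^ 2
    have hX : 0 ≤ X := integral_nonneg fun _ => sq_nonneg _
    have hY : 0 ≤ ∫ y in T, ‖ev p.1 y - ev p.1 c‖ ^ 2 := integral_nonneg fun _ => sq_nonneg _
    rcases hX.eq_or_lt with h0 | h0
    · rwa [← h0]
    · rw [sq] at h1
      exact le_of_mul_le_mul_right h1 h0
  have hxb : x ∈ Metric.closedBall c h := closure_minimal hcl Metric.isClosed_closedBall hx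
  have hqx : ev q.1 x ^ 2 ≤ C₀ * ω * (D2 * h ^ 2) := by
    have h1 := H c h hh q x hxb
    have h2 := (integral_ball_sq_le hb hball (continuous_ev q.1)).trans hqint
    simp only [Real.norm_eq_abs, sq_abs] at h2
    calc ev q.1 x ^ 2 ≤ _ := h1
      _ ≤ C₀ * (h ^ d)⁻¹ * (D2 * h ^ 2 * (h ^ d * ω)) :=
        mul_le_mul_of_nonneg_left h2 (by positivity)
      _ = C₀ * ω * (D2 * h ^ 2) := by field_simp
  have hpx := hosc x hxb
  have hsplit : ev p.1 x - ev (cellProj k T (ev p.1)).1 x = (ev p.1 x - ev p.1 c) - ev q.1 x := by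
    rw [hqev]; ring
  rw [hsplit]
  calc (ev p.1 x - ev p.1 c - ev q.1 x) ^ 2
      ≤ 2 * (ev p.1 x - ev p.1 c) ^ 2 + 2 * ev q.1 x ^ 2 := by
        nlinarith [sq_nonneg (ev p.1 x - ev p.1 c + ev q.1 x)]
    _ ≤ 2 * (D2 * h ^ 2) + 2 * (C₀ * ω * (D2 * h ^ 2)) := by gcongr
    _ = _ := by rw [hD2]; ring

/-- Stability of the face projection: `‖g‖² ≤ 2 ‖π(g - δ)‖² + 2 ‖δ‖²` for a polynomial `g`. -/
theorem Mesh.integral_sq_le_faceProj (M : Mesh Ω) (hd : 1 ≤ d) {F : Set (Euc d)}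
    (hF : F ∈ M.faces) (g : FacePoly k F) {δ : F → ℝ} (hδ : Continuous δ) :
    ∫ x, g.1 x ^ 2 ∂(surf F) ≤
      2 * ∫ x, (faceProj k F fun x => g.1 x - δ x).1 x ^ 2 ∂(surf F) +
        2 * ∫ x, δ x ^ 2 ∂(surf F) := by
  set S := faceProj k F fun x => g.1 x - δ x with hS
  have hcg := continuous_facePoly g
  have hcS := continuous_facePoly S
  have hcd : Continuous fun x => g.1 x - S.1 x := hcg.sub hcS
  have hcδ : Continuous fun x => g.1 x - δ x := hcg.sub hδ
  have hmul : ∀ {f₁ f₂ : F → ℝ}, Continuous f₁ → Continuous f₂ →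
      Integrable (fun y => f₁ y * f₂ y) (surf F) := fun h1 h2 =>
    (M.memLp_surf hd hF h1).integrable_mul (M.memLp_surf hd hF h2)
  have hsq : ∀ {f : F → ℝ}, Continuous f → Integrable (fun y => f y ^ 2) (surf F) :=
    fun h1 => by simpa only [sq] using hmul h1 h1
  have h1 := M.faceProj_spec k hd hF (hcg.sub hδ) (g - S)
  have hw : ∀ x, (g - S).1 x = g.1 x - S.1 x := fun x => rfl
  change ∫ x, S.1 x * (g - S).1 x ∂(surf F) = ∫ x, (g.1 x - δ x) * (g - S).1 x ∂(surf F) at h1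
  simp only [hw] at h1
  -- `g - S` is the projection of `δ`; testing orthogonality with `g - S` itself gives `‖g - S‖² =
  -- (δ, g - S)`.
  have h2 : ∫ x, (g.1 x - S.1 x) ^ 2 ∂(surf F) = ∫ x, δ x * (g.1 x - S.1 x) ∂(surf F) := by
    have e1 : ∀ x, (g.1 x - S.1 x) ^ 2 =
        (g.1 x - δ x) * (g.1 x - S.1 x) - S.1 x * (g.1 x - S.1 x) +
          δ x * (g.1 x - S.1 x) := fun x => by ring
    simp only [e1]
    have hi : Integrable (fun x => (g.1 x - δ x) * (g.1 x - S.1 x) - S.1 x * (g.1 x - S.1 x))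
        (surf F) := (hmul hcδ hcd).sub (hmul hcS hcd)
    rw [integral_add hi (hmul hδ hcd), integral_sub (hmul hcδ hcd) (hmul hcS hcd), h1, sub_self,
      zero_add]
  have h3 : ∫ x, (g.1 x - S.1 x) ^ 2 ∂(surf F) ≤ ∫ x, δ x ^ 2 ∂(surf F) := by
    have h4 : ∫ x, δ x * (g.1 x - S.1 x) ∂(surf F) ≤
        ∫ x, (1 / 2 * δ x ^ 2 + 1 / 2 * (g.1 x - S.1 x) ^ 2) ∂(surf F) := by
      refine integral_mono (hmul hδ hcd)
        (((hsq hδ).const_mul _).add ((hsq hcd).const_mul _)) fun x => ?_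
      nlinarith [sq_nonneg (δ x - (g.1 x - S.1 x))]
    rw [integral_add ((hsq hδ).const_mul _) ((hsq hcd).const_mul _),
      integral_const_mul, integral_const_mul, ← h2] at h4
    linarith
  have h5 : ∫ x, g.1 x ^ 2 ∂(surf F) ≤
      ∫ x, (2 * S.1 x ^ 2 + 2 * (g.1 x - S.1 x) ^ 2) ∂(surf F) := by
    refine integral_mono (hsq hcg)
      (((hsq hcS).const_mul _).add ((hsq hcd).const_mul _)) fun x => ?_
    nlinarith [sq_nonneg (S.1 x - (g.1 x - S.1 x))]
  rw [integral_add ((hsq hcS).const_mul _) ((hsq hcd).const_mul _),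
    integral_const_mul, integral_const_mul] at h5
  linarith

theorem faceSup_nonneg (a : Euc d → ℝ) (F : Set (Euc d)) : 0 ≤ faceSup a F :=
  ENNReal.toReal_nonneg

theorem faceSup_le {a : Euc d → ℝ} {F : Set (Euc d)} {A : ℝ} (hA : 0 ≤ A)
    (h : ∀ x ∈ F, ‖a x‖ ≤ A) : faceSup a F ≤ A := by
  rw [faceSup, eLpNorm_exponent_top]
  refine ENNReal.toReal_le_of_le_ofReal hA (eLpNormEssSup_le_of_ae_bound ?_)
  exact Filter.Eventually.of_forall fun x => h x x.2

/-- The jump on a face is controlled by the stabilization and by `∇R_T`. -/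
theorem exists_jump_le (d k : ℕ) (hd : 2 ≤ d) {r : ℝ} (hr : 0 < r) :
    ∃ C : ℝ, 0 ≤ C ∧ ∀ (Ω : Set (Euc d)) (M : Mesh Ω), ∀ T ∈ M.cells, ∀ (c : Euc d),
      0 < Metric.diam T → Metric.ball c (r * Metric.diam T) ⊆ T →
      T ⊆ Metric.closedBall c (Metric.diam T) →
      ∀ (a : Euc d → ℝ) (A : ℝ), 0 ≤ A → (∀ x ∈ closure T, ‖a x‖ ≤ A) →
      ∀ (v : M.LocalDof k T) (F : M.facesOf T),
        faceSup a F.1 / Metric.diam F.1 *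
            ∫ x : F.1, ((v.2 F).1 x - ev v.1.1 x) ^ 2 ∂(surf F.1) ≤
          2 * (faceSup a F.1 / Metric.diam F.1 *
            ∫ x, (M.stabOp T v F).1 x * (M.stabOp T v F).1 x ∂(surf F.1)) +
          A * C * ∫ x in T, ‖M.gradR T v x‖ ^ 2 := by
  obtain ⟨C, hC, H⟩ := exists_sq_sub_cellProj_le d k hr
  have hfc : 0 ≤ faceConst d := measureReal_nonneg
  refine ⟨2 * faceConst d * C, by positivity, fun Ω M T hT c hh hball hcl a A hA0 hA v F => ?_⟩
  have hF := M.mem_faces_of_mem_facesOf F.2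
  have hd1 : 1 ≤ d := by omega
  have hFT : F.1 ⊆ closure T := (M.subset_frontier_of_mem_facesOf F.2).trans frontier_subset_closure
  have hb := (M.cell_polyhedron T hT).isBounded
  have := M.isFiniteMeasure_surf hd1 hF
  -- The trace of `v_T` has degree at most `k`, so the jump is a face polynomial and is fixed by the
  -- projection in `stabOp`.
  have hvT : restr F.1 v.1.1 ∈ FacePoly k F.1 := ⟨_, v.1.2, rfl⟩
  set g : FacePoly k F.1 := v.2 F - ⟨_, hvT⟩ with hg
  set δ : F.1 → ℝ := fun x =>
    ev (M.potRecon T v).1 x - ev (cellProj k T (ev (M.potRecon T v).1)).1 x with hδ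
  have hδc : Continuous δ := ((continuous_ev _).comp continuous_subtype_val).sub
    ((continuous_ev _).comp continuous_subtype_val)
  have h1 := M.integral_sq_le_faceProj hd1 hF g hδc
  change ∫ x : F.1, ((v.2 F).1 x - ev v.1.1 x) ^ 2 ∂(surf F.1) ≤
    2 * ∫ x, (M.stabOp T v F).1 x ^ 2 ∂(surf F.1) + 2 * ∫ x, δ x ^ 2 ∂(surf F.1) at h1
  set h := Metric.diam T
  set φ := Metric.diam F.1 with hφ
  have hφ0 : 0 ≤ φ := Metric.diam_nonneg
  have hφh : φ ≤ h := by
    exact (Metric.diam_mono hFT hb.closure).trans_eq (Metric.diam_closure T)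
  set I := ∫ x in T, ‖M.gradR T v x‖ ^ 2
  have hI0 : 0 ≤ I := integral_nonneg fun _ => sq_nonneg _
  set E := C * (h ^ 2 * (h ^ d)⁻¹) * I with hE
  have hE0 : 0 ≤ E := by positivity
  have h2 : ∫ x, δ x ^ 2 ∂(surf F.1) ≤ φ ^ (d - 1) * faceConst d * E := by
    have hle : ∫ x, δ x ^ 2 ∂(surf F.1) ≤ ∫ _, E ∂(surf F.1) := by
      refine integral_mono_of_nonneg (Filter.Eventually.of_forall fun _ => sq_nonneg _)
        (integrable_const _) (Filter.Eventually.of_forall fun x => ?_)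
      exact H Ω M T hT c h hh hball hcl (M.potRecon T v) x (hFT x.2)
    refine hle.trans ?_
    rw [integral_const, smul_eq_mul]
    exact mul_le_mul_of_nonneg_right (M.surf_real_univ_le hd1 hF) hE0
  have hfs := faceSup_nonneg a F.1
  have hfA : faceSup a F.1 ≤ A := faceSup_le hA0 fun x hx => hA x (hFT hx)
  -- After one power of `φ` cancels, `φ ^ (d - 2) ≤ h ^ (d - 2)` suffices: for `d ≥ 2` no lower
  -- bound of `diam F` by `diam T` is needed. If `φ = 0` then `φ⁻¹ = 0`.
  have h3 : φ⁻¹ * (φ ^ (d - 1) * faceConst d * E) ≤ faceConst d * C * I := by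
    rcases hφ0.eq_or_lt with h0 | h0
    · rw [← h0]; simp only [inv_zero, zero_mul]; positivity
    · have e1 : φ ^ (d - 1) = φ * φ ^ (d - 2) := by
        rw [← pow_succ']; congr 1; omega
      have e2 : h ^ d = h ^ (d - 2) * h ^ 2 := by
        rw [← pow_add]; congr 1; omega
      have h4 : φ ^ (d - 2) ≤ h ^ (d - 2) := pow_le_pow_left₀ hφ0 hφh _
      calc φ⁻¹ * (φ ^ (d - 1) * faceConst d * E) = φ ^ (d - 2) * (faceConst d * E) := by
            rw [e1]; field_simp
        _ ≤ h ^ (d - 2) * (faceConst d * E) := mul_le_mul_of_nonneg_right h4 (by positivity)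
        _ = faceConst d * C * I := by rw [hE, e2]; field_simp
  have h5 : faceSup a F.1 * (φ⁻¹ * (φ ^ (d - 1) * faceConst d * E)) ≤
      A * (faceConst d * C * I) := mul_le_mul hfA h3 (by positivity) hA0
  simp only [← sq]
  calc faceSup a F.1 / φ * ∫ x : F.1, ((v.2 F).1 x - ev v.1.1 x) ^ 2 ∂(surf F.1)
      ≤ faceSup a F.1 / φ * (2 * ∫ x, (M.stabOp T v F).1 x ^ 2 ∂(surf F.1) +
          2 * (φ ^ (d - 1) * faceConst d * E)) := by
        refine mul_le_mul_of_nonneg_left ?_ (by positivity)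
        linarith
    _ = 2 * (faceSup a F.1 / φ * ∫ x, (M.stabOp T v F).1 x ^ 2 ∂(surf F.1)) +
          2 * (faceSup a F.1 * (φ⁻¹ * (φ ^ (d - 1) * faceConst d * E))) := by
        rw [div_eq_mul_inv]; ring
    _ ≤ 2 * (faceSup a F.1 / φ * ∫ x, (M.stabOp T v F).1 x ^ 2 ∂(surf F.1)) +
          2 * (A * (faceConst d * C * I)) := by linarith
    _ = _ := by ring

end Local

/-! ### Regular meshes -/

section Regular

variable {d : ℕ} {Ω : Set (Euc d)} {M : Mesh Ω} {T : Set (Euc d)}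

theorem diam_pos_of_isOpen (hd : 1 ≤ d) (hT : IsOpen T) (hne : T.Nonempty)
    (hb : Bornology.IsBounded T) : 0 < Metric.diam T := by
  refine lt_of_le_of_ne Metric.diam_nonneg fun h0 => ?_
  obtain ⟨c, hc⟩ := hne
  have hsub : T ⊆ Metric.closedBall c 0 := fun y hy => by
    rw [h0]; exact Metric.dist_le_diam_of_mem hb hy hc
  have hle := measure_mono (μ := volume) hsub
  rw [Measure.addHaar_closedBall _ _ le_rfl, finrank_euclideanSpace, Fintype.card_fin,
    zero_pow (by omega), ENNReal.ofReal_zero, zero_mul] at hle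
  exact (hT.measure_pos volume ⟨c, hc⟩).ne' (le_antisymm hle bot_le)

/-- A submesh simplex in `T` contains a ball of radius `ϱ` times its diameter, which is at least `ϱ
* diam T`; hence the factor `ϱ * ϱ`. -/
theorem Mesh.IsRegular.exists_ball (hd : 1 ≤ d) {ϱ : ℝ} (hϱ : 0 < ϱ) (h : M.IsRegular ϱ)
    (hT : T ∈ M.cells) :
    ∃ c, Metric.ball c (ϱ * ϱ * Metric.diam T) ⊆ T ∧ T ⊆ Metric.closedBall c (Metric.diam T) := by
  obtain ⟨K, hK, hin, hcell, -⟩ := h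
  have hTp := M.cell_polyhedron T hT
  obtain ⟨x, hx⟩ := M.cell_nonempty T hT
  obtain ⟨t, ht, hc, htT, -⟩ :=
    hK.exists_simplex_of_mem_closure hT hTp.isOpen subset_rfl (subset_closure hx)
  obtain ⟨c, hball⟩ := hin t ht hc
  have hle := hcell t ht hc T hT htT
  have hsub : Metric.ball c (ϱ * ϱ * Metric.diam T) ⊆ T := by
    refine (interior_maximal ((Metric.ball_subset_ball ?_).trans hball)
      Metric.isOpen_ball).trans htT
    rw [mul_assoc]
    exact mul_le_mul_of_nonneg_left hle hϱ.le
  have hpos := diam_pos_of_isOpen hd hTp.isOpen ⟨x, hx⟩ hTp.isBounded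
  refine ⟨c, hsub, fun y hy => Metric.dist_le_diam_of_mem hTp.isBounded hy (hsub ?_)⟩
  exact Metric.mem_ball_self (by positivity)

/-- On a regular mesh, the number of faces of a cell is bounded. -/
theorem Mesh.IsRegular.card_facesOf_le (hd : 1 ≤ d) {ϱ : ℝ} (hϱ : 0 < ϱ) (h : M.IsRegular ϱ)
    (hT : T ∈ M.cells) : ((M.facesOf T).card : ℝ) ≤ (d + 1) * ((ϱ * ϱ) ^ d)⁻¹ := by
  obtain ⟨K, hK, hin, hcell, -⟩ := h
  have hTp := M.cell_polyhedron T hT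
  have hpos := diam_pos_of_isOpen hd hTp.isOpen (M.cell_nonempty T hT) hTp.isBounded
  have h1 := ncard_cellSimplices_le hK.finite hTp.isBounded (M.cell_nonempty T hT)
    (r := ϱ * ϱ * Metric.diam T) (by positivity) fun t ht => by
      obtain ⟨c, hball⟩ := hin t ht.1 ht.2.1
      refine ⟨c, (Metric.ball_subset_ball ?_).trans hball⟩
      rw [mul_assoc]
      exact mul_le_mul_of_nonneg_left (hcell t ht.1 ht.2.1 T hT ht.2.2) hϱ.le
  have h2 : ((cellSimplices K T).ncard : ℝ) ≤ ((ϱ * ϱ) ^ d)⁻¹ := by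
    rw [mul_pow, ← mul_assoc] at h1
    rw [← one_div, le_div_iff₀ (by positivity)]
    exact le_of_mul_le_mul_right (by simpa using h1) (pow_pos hpos d)
  have h3 : ((M.facesOf T).card : ℝ) ≤ (d + 1) * (cellSimplices K T).ncard := by
    exact_mod_cast hK.card_facesOf_le hT
  exact h3.trans (mul_le_mul_of_nonneg_left h2 (by positivity))

end Regular

/-! ### The Gårding inequality -/

section Garding

variable {d k : ℕ} {Ω : Set (Euc d)}

theorem Mesh.stab_nonneg (M : Mesh Ω) (T : Set (Euc d)) (a : Euc d → ℝ) (v : M.LocalDof k T) :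
    0 ≤ M.stab T a v v :=
  Finset.sum_nonneg fun _ _ => mul_nonneg (div_nonneg (faceSup_nonneg _ _) Metric.diam_nonneg)
    (integral_nonneg fun _ => mul_self_nonneg _)

/-- Pointwise Young inequality; the weight `α / 2` lets half of the diffusion absorb the gradient
term. -/
theorem Mesh.integral_advection_ge (M : Mesh Ω) {T : Set (Euc d)} (hT : T ∈ M.cells)
    {b : Euc d → Euc d} {β α : ℝ} (hα : 0 < α)
    (hb : ∀ᵐ x ∂(volume.restrict T), ‖b x‖ ≤ β) (v : M.LocalDof k T) :
    -(α / 2 * (∫ x in T, ‖M.gradR T v x‖ ^ 2) + β ^ 2 / (2 * α) * ∫ x in T, ev v.1.1 x ^ 2) ≤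
      ∫ x in T, inner ℝ (b x) (M.gradR T v x) * ev v.1.1 x := by
  have hbd := (M.cell_polyhedron T hT).isBounded
  have i1 : Integrable (fun x => α / 2 * ‖M.gradR T v x‖ ^ 2) (volume.restrict T) :=
    (integrableOn_norm_sq (continuous_evVec _) hbd).const_mul _
  have i2 : Integrable (fun x => β ^ 2 / (2 * α) * ev v.1.1 x ^ 2) (volume.restrict T) := by
    simpa using (integrableOn_norm_sq (continuous_ev v.1.1) hbd).const_mul (β ^ 2 / (2 * α))
  have key := norm_integral_le_of_norm_le (i1.add i2)
    (f := fun x => inner ℝ (b x) (M.gradR T v x) * ev v.1.1 x) (by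
      filter_upwards [hb] with x hx
      have h1 : ‖inner ℝ (b x) (M.gradR T v x)‖ ≤ β * ‖M.gradR T v x‖ :=
        (norm_inner_le_norm _ _).trans (mul_le_mul_of_nonneg_right hx (norm_nonneg _))
      rw [norm_mul]
      refine (mul_le_mul_of_nonneg_right h1 (norm_nonneg _)).trans ?_
      rw [Pi.add_apply, ← sq_abs (ev v.1.1 x), ← Real.norm_eq_abs]
      set X := ‖M.gradR T v x‖
      set Y := ‖ev v.1.1 x‖
      have h2 : α / 2 * X ^ 2 + β ^ 2 / (2 * α) * Y ^ 2 - β * X * Y =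
          (α * X - β * Y) ^ 2 / (2 * α) := by field_simp; ring
      have h3 : 0 ≤ (α * X - β * Y) ^ 2 / (2 * α) := by positivity
      linarith)
  simp only [Pi.add_apply] at key
  rw [integral_add i1 i2, integral_const_mul, integral_const_mul] at key
  exact (abs_le.1 key).1

/-- The cells are disjoint and `cellFun` equals `v_T` on each. As only an inequality is needed, the
skeleton need not be shown to be null. -/
theorem Mesh.sum_integral_sq_le_l2Norm_sq (M : Mesh Ω) (hΩ : Bornology.IsBounded Ω)
    (v : M.Dof k) : ∑ T : M.cells, ∫ x in T.1, ev (v.1 T).1 x ^ 2 ≤ M.l2Norm v ^ 2 := by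
  classical
  rw [Mesh.l2Norm, Real.sq_sqrt (integral_nonneg fun _ => sq_nonneg _)]
  have hmeas : ∀ T : M.cells, MeasurableSet T.1 := fun T =>
    (M.cell_polyhedron T T.2).isOpen.measurableSet
  have hmem : MemLp v.cellFun 2 (volume.restrict Ω) := by
    have h : MemLp (fun x => ∑ T : M.cells, T.1.indicator (ev (v.1 T).1) x) 2
        (volume.restrict Ω) :=
      memLp_finsetSum _ fun T _ =>
        (memLp_two_of_continuous (continuous_ev _) hΩ).indicator (hmeas T)
    convert h using 1
    funext x
    simp [Dof.cellFun, Set.indicator_apply]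
  have hint : IntegrableOn (fun x => v.cellFun x ^ 2) Ω := hmem.integrable_sq
  have hdisj : Pairwise (Function.onFun Disjoint fun T : M.cells => T.1) := fun T T' hne =>
    M.cell_disjoint T T.2 T' T'.2 fun e => hne (Subtype.ext e)
  have hsub : (⋃ T : M.cells, T.1) ⊆ Ω := iUnion_subset fun T => M.cell_subset T T.2
  have heq : ∀ T : M.cells, ∫ x in T.1, ev (v.1 T).1 x ^ 2 = ∫ x in T.1, v.cellFun x ^ 2 := by
    intro T
    refine setIntegral_congr_fun (hmeas T) fun x hx => ?_
    have : v.cellFun x = ev (v.1 T).1 x := by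
      rw [Dof.cellFun, Finset.sum_eq_single T]
      · simp [hx]
      · intro T' _ hne
        have : x ∉ T'.1 := fun hx' => Set.disjoint_left.1 (hdisj hne) hx' hx
        simp [this]
      · simp
    simp only [this]
  rw [Finset.sum_congr rfl fun T _ => heq T,
    ← integral_iUnion_fintype hmeas hdisj fun T => hint.mono_set (M.cell_subset T T.2)]
  exact setIntegral_mono_set hint (Filter.Eventually.of_forall fun _ => sq_nonneg _)
    (LE.le.eventuallyLE hsub)

theorem Mesh.localEnergySq_nonneg (M : Mesh Ω) (T : Set (Euc d)) (a : Euc d → ℝ)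
    (v : M.LocalDof k T) : 0 ≤ M.localEnergySq T a v :=
  add_nonneg (integral_nonneg fun _ => sq_nonneg _) (Finset.sum_nonneg fun _ _ =>
    mul_nonneg (div_nonneg (faceSup_nonneg _ _) Metric.diam_nonneg)
      (integral_nonneg fun _ => sq_nonneg _))

/-- The Gårding inequality on one cell. -/
theorem Mesh.localForm_ge (M : Mesh Ω) (hd : 1 ≤ d) {T : Set (Euc d)} (hT : T ∈ M.cells)
    {a : Euc d → ℝ} {b : Euc d → Euc d} {a₀ : Euc d → ℝ} {α β N : ℝ} (hα : 0 < α)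
    (hN : 0 ≤ N) (haα : ∀ x ∈ closure T, α ≤ a x) (hac : ContinuousOn a (closure T))
    (hb : ∀ᵐ x ∂(volume.restrict T), ‖b x‖ ≤ β) (ha₀ : ∀ᵐ x ∂(volume.restrict T), 0 ≤ a₀ x)
    (v : M.LocalDof k T)
    (hjump : ∑ F : M.facesOf T, faceSup a F.1 / Metric.diam F.1 *
        ∫ x : F.1, ((v.2 F).1 x - ev v.1.1 x) ^ 2 ∂(surf F.1) ≤
      2 * M.stab T a v v + N * ∫ x in T, ‖M.gradR T v x‖ ^ 2) :
    1 / (2 * (2 + N / α)) * M.localEnergySq T a v - β ^ 2 / (2 * α) * ∫ x in T, ev v.1.1 x ^ 2 ≤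
      M.localForm T a b a₀ v v := by
  have hTp := M.cell_polyhedron T hT
  have hbd := hTp.isBounded
  have hadv := M.integral_advection_ge hT hα hb v
  have hR := M.integral_norm_gradR_sq_le hd hT v
  have hstab := M.stab_nonneg T a v
  have hreact : 0 ≤ ∫ x in T, a₀ x * ev v.1.1 x * ev v.1.1 x := by
    refine integral_nonneg_of_ae ?_
    filter_upwards [ha₀] with x hx
    rw [mul_assoc]
    exact mul_nonneg hx (mul_self_nonneg _)
  have hY1 : ∫ x in T, ‖Real.sqrt (a x) • M.G T v x‖ ^ 2 = ∫ x in T, a x * ‖M.G T v x‖ ^ 2 := by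
    refine setIntegral_congr_fun hTp.isOpen.measurableSet fun x hx => ?_
    rw [norm_smul, mul_pow, Real.norm_of_nonneg (Real.sqrt_nonneg _),
      Real.sq_sqrt (hα.le.trans (haα x (subset_closure hx)))]
  have hGc : Continuous (M.G T v) := continuous_evVec _
  have hYint : IntegrableOn (fun x => a x * ‖M.G T v x‖ ^ 2) T :=
    ((hac.mul (hGc.norm.pow 2).continuousOn).integrableOn_compact
      hbd.isCompact_closure).mono_set subset_closure
  have hXY : α * ∫ x in T, ‖M.G T v x‖ ^ 2 ≤ ∫ x in T, a x * ‖M.G T v x‖ ^ 2 := by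
    rw [← integral_const_mul]
    exact setIntegral_mono_on ((integrableOn_norm_sq hGc hbd).const_mul α) hYint
      hTp.isOpen.measurableSet fun x hx =>
        mul_le_mul_of_nonneg_right (haα x (subset_closure hx)) (sq_nonneg _)
  simp only [Mesh.localForm, Mesh.localEnergySq, real_inner_self_eq_norm_sq]
  rw [hY1]
  set Y := ∫ x in T, a x * ‖M.G T v x‖ ^ 2
  set X := ∫ x in T, ‖M.G T v x‖ ^ 2
  set I := ∫ x in T, ‖M.gradR T v x‖ ^ 2
  set J := ∑ F : M.facesOf T, faceSup a F.1 / Metric.diam F.1 *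
        ∫ x : F.1, ((v.2 F).1 x - ev v.1.1 x) ^ 2 ∂(surf F.1)
  set S := M.stab T a v v
  have hX0 : 0 ≤ X := integral_nonneg fun _ => sq_nonneg _
  have hY0 : 0 ≤ Y := (mul_nonneg hα.le hX0).trans hXY
  have hαI : α * I ≤ Y := (mul_le_mul_of_nonneg_left hR hα.le).trans hXY
  have hNI : N * I ≤ N / α * Y := by
    rw [div_mul_eq_mul_div, le_div_iff₀ hα, mul_assoc, mul_comm I]
    exact mul_le_mul_of_nonneg_left hαI hN
  have hNα : 0 ≤ N / α := by positivity
  -- `Y + J ≤ (1 + N / α) Y + 2 S ≤ (2 + N / α) (Y + 2 S)`, which is `2 (2 + N / α)` times `Y / 2 +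
  -- S`.
  have henergy : 1 / (2 * (2 + N / α)) * (Y + J) ≤ Y / 2 + S := by
    rw [one_div, inv_mul_le_iff₀ (by positivity)]
    nlinarith [mul_nonneg hNα hstab, mul_nonneg hNα hY0]
  linarith

/-- The Gårding inequality on regular meshes. -/
theorem exists_garding (hd : 2 ≤ d) (k : ℕ) (hΩ : Bornology.IsBounded Ω)
    {a : Euc d → ℝ} {b : Euc d → Euc d} {a₀ : Euc d → ℝ} (hA : CoeffAssumption Ω a b a₀)
    {ϱ : ℝ} (hϱ : 0 < ϱ) :
    ∃ C₁ C₂ : ℝ, 0 < C₁ ∧ 0 < C₂ ∧ ∀ M : Mesh Ω, M.IsRegular ϱ → ∀ v : M.Dof k,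
      C₁ * M.energyNorm a v ^ 2 - C₂ * M.l2Norm v ^ 2 ≤ M.form a b a₀ v v := by
  have hd1 : 1 ≤ d := by omega
  obtain ⟨α, hα, haα⟩ := hA.elliptic
  obtain ⟨A, hAb⟩ := hΩ.isCompact_closure.exists_bound_of_continuousOn hA.a_cont
  obtain ⟨β, hβ⟩ : ∃ β : ℝ, ∀ᵐ x ∂(volume.restrict Ω), ‖b x‖ ≤ β := by
    refine ⟨(eLpNorm b ⊤ (volume.restrict Ω)).toReal, ?_⟩
    filter_upwards [ae_le_eLpNormEssSup (f := b) (μ := volume.restrict Ω)] with x hx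
    rw [← eLpNorm_exponent_top] at hx
    simpa using ENNReal.toReal_mono hA.b_mem.2.ne hx
  obtain ⟨C, hC, hjump⟩ := exists_jump_le d k hd (mul_pos hϱ hϱ)
  set A' := max A 0
  -- The bound on the number of faces of a cell times the jump constant of a single face.
  set N : ℝ := (d + 1) * ((ϱ * ϱ) ^ d)⁻¹ * (A' * C)
  have hA'0 : 0 ≤ A' := le_max_right _ _
  have hN : 0 ≤ N := by positivity
  -- The summand `1` keeps the second constant positive when `β = 0`.
  refine ⟨1 / (2 * (2 + N / α)), β ^ 2 / (2 * α) + 1, by positivity, by positivity,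
    fun M hM v => ?_⟩
  have hlocal : ∀ T : M.cells, 1 / (2 * (2 + N / α)) * M.localEnergySq T.1 a (v.loc T) -
      β ^ 2 / (2 * α) * ∫ x in T.1, ev (v.1 T).1 x ^ 2 ≤
        M.localForm T.1 a b a₀ (v.loc T) (v.loc T) := by
    intro T
    have hTp := M.cell_polyhedron T T.2
    have hTΩ := M.cell_subset T T.2
    have hcl := closure_mono hTΩ
    obtain ⟨c, hball, hsub⟩ := hM.exists_ball hd1 hϱ T.2
    refine M.localForm_ge hd1 T.2 hα hN (fun x hx => haα x (hcl hx)) (hA.a_cont.mono hcl)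
      (ae_restrict_of_ae_restrict_of_subset hTΩ hβ)
      (ae_restrict_of_ae_restrict_of_subset hTΩ hA.a₀_nonneg) (v.loc T) ?_
    refine (Finset.sum_le_sum fun F _ => hjump Ω M T T.2 c
      (diam_pos_of_isOpen hd1 hTp.isOpen (M.cell_nonempty T T.2) hTp.isBounded) hball hsub a A'
      hA'0 (fun x hx => (hAb x (hcl hx)).trans (le_max_left _ _)) (v.loc T) F).trans ?_
    rw [Finset.sum_add_distrib, ← Finset.mul_sum, Finset.sum_const, nsmul_eq_mul,
      Finset.card_univ, Fintype.card_coe, ← mul_assoc]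
    refine add_le_add le_rfl (mul_le_mul_of_nonneg_right ?_ (integral_nonneg fun _ => sq_nonneg _))
    exact mul_le_mul_of_nonneg_right (hM.card_facesOf_le hd1 hϱ T.2) (by positivity)
  have hsum := Finset.sum_le_sum fun T (_ : T ∈ Finset.univ) => hlocal T
  rw [Finset.sum_sub_distrib, ← Finset.mul_sum, ← Finset.mul_sum] at hsum
  rw [Mesh.energyNorm, Real.sq_sqrt (Finset.sum_nonneg fun _ _ => M.localEnergySq_nonneg _ _ _)]
  refine le_trans (sub_le_sub_left ?_ _) hsum
  refine mul_le_mul (by linarith) (M.sum_integral_sq_le_l2Norm_sq hΩ v)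
    (Finset.sum_nonneg fun _ _ => integral_nonneg fun _ => sq_nonneg _) (by positivity)

end Garding

end

end HHO

theorem mainTheorem7 {d : ℕ} (hd : d = 2 ∨ d = 3) (k : ℕ)
    (Ω : Set (HHO.Euc d)) (hΩ : HHO.IsConvexPolytopalDomain Ω)
    (a : HHO.Euc d → ℝ) (b : HHO.Euc d → HHO.Euc d) (a₀ : HHO.Euc d → ℝ)
    (hA : HHO.CoeffAssumption Ω a b a₀)
    {ι : Type*} (𝓣 : ι → HHO.Mesh Ω) (h𝓣 : HHO.IsAdmissible 𝓣) :
    ∃ C₁ C₂ : ℝ, 0 < C₁ ∧ 0 < C₂ ∧ ∀ (i : ι) (v : (𝓣 i).Dof k),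
      (𝓣 i).form a b a₀ v v ≥
        C₁ * (𝓣 i).energyNorm a v ^ 2 - C₂ * (𝓣 i).l2Norm v ^ 2 := by
  have hb : Bornology.IsBounded Ω := by
    obtain ⟨-, s, rfl⟩ := hΩ
    exact (s.finite_toSet.isCompact_convexHull ℝ).isBounded.subset interior_subset
  obtain ⟨ϱ, hϱ, -, hreg⟩ := h𝓣
  obtain ⟨C₁, C₂, h₁, h₂, H⟩ := HHO.exists_garding (by omega) k hb hA hϱ
  exact ⟨C₁, C₂, h₁, h₂, fun i v => H (𝓣 i) (hreg i) v⟩
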